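/- Let $G$ be a simply connected real Lie group, $H\subset G$ a closed connected (embedded Lie) subgroup, $\mathfrak g$ and $\mathfrak h$ their Lie algebras, and $\mathfrak g=\mathfrak h\oplus\mathfrak m$ with $[\mathfrak h,\mathfrak m]\subset\mathfrak m$ and $[\mathfrak m,\mathfrak m]\subset\mathfrak h$. Let $\omega_0$ be an $\operatorname{ad}(\mathfrak h)$-invariant non-degenerate skew-symmetric bilinear form on $\mathfrak m$ and $J_0$ an $\operatorname{ad}(\mathfrak h)$-invariant complex structure on $\mathfrak m$ such that $\mathbf g_0(X,Y)=\omega_0(X,J_0Y)$ is an inner product, so that $G/H$ is a Hermitian symmetric space. Fix a unitary basis $(X_1,\dots,X_{2n})$ of $\mathfrak m$, $n\ge 1$, i.e. $\omega_0(X_j,X_k)=\omega_0(X_{n+j},X_{n+k})=0$, $\omega_0(X_j,X_{n+k})=\delta_{jk}$ and $J_0X_j=X_{n+j}$ for $j,k=1,\dots,n$, and use it to identify $\mathrm{Sp}(\mathfrak m,\omega_0)$ with $\mathrm{Sp}(n,\mathbb R)$. Let $\rho:\mathrm{Mp}(n,\mathbb R)\to\mathrm{Sp}(n,\mathbb R)$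 be the connected double cover and $\boldsymbol m:\mathrm{Mp}(n,\mathbb R)\to\mathrm U(L^2(\mathbb R^n))$ the metaplectic representation, which satisfies $\boldsymbol m(q)\,r(v)\,\boldsymbol m(q)^{-1}=r(\rho(q)v)$ for the operators $(r(a,b)f)(x)=e^{i(a\cdot x+a\cdot b/2)}f(x+b)$, where $v=(a,b)\in\mathbb R^n\times\mathbb R^n$. Let $\tilde\kappa:H\to\mathrm{Mp}(n,\mathbb R)$ be a continuous homomorphism lifting the isotropy representation $\kappa:H\to\mathrm{Sp}(\mathfrak m)$, $\kappa(h)=\operatorname{Ad}(h)|_{\mathfrak m}$, i.e. $\rho\circ\tilde\kappa=\kappa$. Put $\lambda=\boldsymbol m\circ\tilde\kappa$ and let $Q=G\times_\lambda L^2(\mathbb R^n)$ be the symplectic spinor bundle over $G/H$. For $l\in\mathbb N_0$ let $\mathfrak W_l\subset L^2(\mathbb R^n)$ be the span of the Hermite functions $\boldsymbol h_\alpha(x)=\prod_j \boldsymbol h_{\alpha_j}(x_j)$ with $\alpha\in\mathbb N_0^n$, $\alpha_1+\dots+\alpha_n=l$, where $\boldsymbol h_k(t)=e^{t^2/2}\frac{d^k}{dt^k}e^{-t^2}$.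 Then $\tilde\kappa$ takes values in $\hat{\mathrm U}(n)=\rho^{-1}(\mathrm U(n))$, each $\mathfrak W_l$ is invariant under $\boldsymbol u=\boldsymbol m|_{\hat{\mathrm U}(n)}$, and with $\boldsymbol u_l=\boldsymbol u|_{\mathfrak W_l}$ and $\lambda_l=\boldsymbol u_l\circ\tilde\kappa$ the bundle $Q$ is the orthogonal Hilbert sum of the finite-rank subbundles $Q_l=G\times_{\lambda_l}\mathfrak W_l$, $l\in\mathbb N_0$. That is: the fibres of $Q_l$ are finite-dimensional; over each point of $G/H$ the fibre of $Q$ is the Hilbert sum of the mutually orthogonal fibres of the $Q_l$; the natural maps $Q_l\to Q$ are closed embeddings; and around each point of $G/H$ there are local trivializations of $Q$ and of all the $Q_l$ over a common neighbourhood $U$, isometric on each fibre, in which every $Q_l\to Q$ becomes the inclusion $U\times\mathfrak W_l\subset U\times L^2(\mathbb R^n)$. -/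

import Mathlib

open MeasureTheory Manifold ContDiff Matrix Topology

noncomputable section

namespace SymplecticSpinor

/-! ## The metaplectic group and the metaplectic representation -/

section Metaplectic

/-- The Hilbert space `L²(ℝⁿ)` of complex square-integrable functions. -/
abbrev L2 (n : ℕ) : Type := Lp ℂ 2 (volume : Measure (EuclideanSpace ℝ (Fin n)))

/-- `(a, b)` acts on functions by `f ↦ exp (i (a · x + a · b / 2)) f (x + b)`. Formally this is the
exponential of the symplectic Clifford multiplication by `∑ aⱼ Xⱼ + ∑ bⱼ Xₙ₊ⱼ`, where `Xⱼ` acts as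
multiplication by `i xⱼ` and `Xₙ₊ⱼ` acts as `∂/∂xⱼ`. -/
def weylFun {n : ℕ} (v : Fin n ⊕ Fin n → ℝ) (f : EuclideanSpace ℝ (Fin n) → ℂ)
    (x : EuclideanSpace ℝ (Fin n)) : ℂ :=
  Complex.exp (Complex.I * ((∑ j, v (Sum.inl j) * (x j + v (Sum.inr j) / 2) : ℝ) : ℂ)) *
    f (x + WithLp.toLp 2 (fun j => v (Sum.inr j)))

theorem memLp_weylFun {n : ℕ} (v : Fin n ⊕ Fin n → ℝ) (f : L2 n) :
    MemLp (weylFun v f) 2 volume := by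
  have h1 : MemLp (fun x => (f : EuclideanSpace ℝ (Fin n) → ℂ)
      (x + WithLp.toLp 2 (fun j => v (Sum.inr j)))) 2 volume :=
    (Lp.memLp f).comp_measurePreserving (measurePreserving_add_right volume _)
  refine h1.congr_norm ?_ (Filter.Eventually.of_forall fun x => ?_)
  · refine AEStronglyMeasurable.mul (Continuous.aestronglyMeasurable ?_) h1.1
    fun_prop
  · rw [weylFun, norm_mul, mul_comm Complex.I, Complex.norm_exp_ofReal_mul_I, one_mul]

/-- The Weyl operators, i.e. the Schrödinger representation of the Heisenberg group
on `L²(ℝⁿ)`. -/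
def weyl {n : ℕ} (v : Fin n ⊕ Fin n → ℝ) (f : L2 n) : L2 n := (memLp_weylFun v f).toLp

/-- The group of all pairs `(A, U)` of a symplectic matrix `A` and a unitary operator `U` on
`L²(ℝⁿ)` that implements `A`, i.e. `U r(v) U⁻¹ = r(A v)` for the Weyl operators `r(v)`. By the
theorems of Stone, von Neumann, Shale and Weil this is the extension of `Sp(n, ℝ)` by the group
of scalars of modulus one that is usually denoted by `Mpᶜ(n)`. -/
def MpC (n : ℕ) : Subgroup (symplecticGroup (Fin n) ℝ × (L2 n ≃ₗᵢ[ℂ] L2 n)) where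
  carrier := {p | ∀ (v : Fin n ⊕ Fin n → ℝ) (f : L2 n),
    p.2 (weyl v f) = weyl ((p.1 : Matrix (Fin n ⊕ Fin n) (Fin n ⊕ Fin n) ℝ) *ᵥ v) (p.2 f)}
  one_mem' := by
    intro v f
    simp
  mul_mem' := by
    intro p q hp hq v f
    have h1 := hq v f
    have h2 := hp ((q.1 : Matrix (Fin n ⊕ Fin n) (Fin n ⊕ Fin n) ℝ) *ᵥ v) (q.2 f)
    simp only [Prod.snd_mul, Prod.fst_mul, LinearIsometryEquiv.coe_mul, Function.comp_apply,
      Submonoid.coe_mul]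
    rw [h1, h2, Matrix.mulVec_mulVec]
  inv_mem' := by
    intro p hp v f
    have h1 := hp (((p.1⁻¹ : symplecticGroup (Fin n) ℝ) :
      Matrix (Fin n ⊕ Fin n) (Fin n ⊕ Fin n) ℝ) *ᵥ v) (p.2⁻¹ f)
    have h2 : ((p.1 : Matrix (Fin n ⊕ Fin n) (Fin n ⊕ Fin n) ℝ) *
        ((p.1⁻¹ : symplecticGroup (Fin n) ℝ) : Matrix (Fin n ⊕ Fin n) (Fin n ⊕ Fin n) ℝ)) = 1 := by
      rw [← Submonoid.coe_mul, mul_inv_cancel, Submonoid.coe_one]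
    have h3 : ∀ g : L2 n, p.2 (p.2⁻¹ g) = g := fun g => p.2.apply_symm_apply g
    rw [Matrix.mulVec_mulVec, h2, Matrix.one_mulVec, h3] at h1
    change p.2⁻¹ (weyl v f) = weyl _ (p.2⁻¹ f)
    rw [← h1]
    exact p.2.symm_apply_apply _

/-- The metaplectic group `Mp(n, ℝ)`, the connected double cover of `Sp(n, ℝ)` (for `n ≥ 1`),
realized by unitary operators. As `Mp(n, ℝ)` is perfect and `Mpᶜ(n)` is generated by `Mp(n, ℝ)`
and the central subgroup of scalars, `Mp(n, ℝ)` is the commutator subgroup of `Mpᶜ(n)`. -/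
def Mp (n : ℕ) : Type := ↥⁅MpC n, MpC n⁆

instance (n : ℕ) : Group (Mp n) := inferInstanceAs (Group ↥⁅MpC n, MpC n⁆)

/-- The covering homomorphism `ρ : Mp(n, ℝ) → Sp(n, ℝ)`. -/
def Mp.rho {n : ℕ} : Mp n →* symplecticGroup (Fin n) ℝ :=
  (MonoidHom.fst _ _).comp (Subgroup.subtype ⁅MpC n, MpC n⁆)

/-- The metaplectic representation `Mp(n, ℝ) → U(L²(ℝⁿ))`. -/
def Mp.rep {n : ℕ} : Mp n →* (L2 n ≃ₗᵢ[ℂ] L2 n) :=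
  (MonoidHom.snd _ _).comp (Subgroup.subtype ⁅MpC n, MpC n⁆)

/-- The topology of `Mp(n, ℝ)`, induced by the usual topology of `Sp(n, ℝ)` and the strong operator
topology. -/
instance (n : ℕ) : TopologicalSpace (Mp n) :=
  TopologicalSpace.induced (fun q => (Mp.rho q, fun f : L2 n => Mp.rep q f)) inferInstance

/-- The preimage `Û(n) = ρ⁻¹(U(n))` of the unitary group, which consists of the symplectic
matrices commuting with the standard complex structure `J`. -/
def UHat (n : ℕ) : Subgroup (Mp n) where
  carrier := {q | ((Mp.rho q : symplecticGroup (Fin n) ℝ) :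
      Matrix (Fin n ⊕ Fin n) (Fin n ⊕ Fin n) ℝ) * Matrix.J (Fin n) ℝ =
    Matrix.J (Fin n) ℝ * (Mp.rho q : symplecticGroup (Fin n) ℝ)}
  one_mem' := by simp
  mul_mem' := by
    intro p q hp hq
    simp only [Set.mem_ofPred_eq, map_mul, Submonoid.coe_mul] at *
    rw [Matrix.mul_assoc, hq, ← Matrix.mul_assoc, hp, Matrix.mul_assoc]
  inv_mem' := by
    intro p hp
    have h1 : ((Mp.rho p : Matrix (Fin n ⊕ Fin n) (Fin n ⊕ Fin n) ℝ) *
        (((Mp.rho p)⁻¹ : symplecticGroup (Fin n) ℝ) :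
          Matrix (Fin n ⊕ Fin n) (Fin n ⊕ Fin n) ℝ)) = 1 := by
      rw [← Submonoid.coe_mul, mul_inv_cancel, Submonoid.coe_one]
    have h2 : ((((Mp.rho p)⁻¹ : symplecticGroup (Fin n) ℝ) :
          Matrix (Fin n ⊕ Fin n) (Fin n ⊕ Fin n) ℝ) * (Mp.rho p)) = 1 := by
      rw [← Submonoid.coe_mul, inv_mul_cancel, Submonoid.coe_one]
    simp only [Set.mem_ofPred_eq, map_inv] at *
    generalize (((Mp.rho p)⁻¹ : symplecticGroup (Fin n) ℝ) :
          Matrix (Fin n ⊕ Fin n) (Fin n ⊕ Fin n) ℝ) = B at *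
    generalize (Mp.rho p : Matrix (Fin n ⊕ Fin n) (Fin n ⊕ Fin n) ℝ) = A at *
    calc B * J (Fin n) ℝ = B * (J (Fin n) ℝ * A) * B := by
          rw [Matrix.mul_assoc, Matrix.mul_assoc, h1, Matrix.mul_one]
      _ = J (Fin n) ℝ * B := by
          rw [← hp, ← Matrix.mul_assoc, h2, Matrix.one_mul]

end Metaplectic

/-! ## Hermite functions -/

section Hermite

/-- The classical Hermite function `h_l(t) = exp (t² / 2) (d/dt)^l exp (- t²)`. -/
def hermite1 (l : ℕ) (t : ℝ) : ℝ :=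
  Real.exp (t ^ 2 / 2) * iteratedDeriv l (fun s : ℝ => Real.exp (-s ^ 2)) t

/-- The Hermite function `h_α(x) = h_{α₁}(x₁) ⋯ h_{αₙ}(xₙ)`. -/
def hermiteFun {n : ℕ} (α : Fin n → ℕ) (x : EuclideanSpace ℝ (Fin n)) : ℂ :=
  ((∏ j, hermite1 (α j) (x j) : ℝ) : ℂ)

theorem exists_hermite1_eq (l : ℕ) :
    ∃ p : Polynomial ℝ, ∀ t, hermite1 l t = p.eval t * Real.exp (-(t ^ 2) / 2) := by
  have key : ∃ p : Polynomial ℝ, iteratedDeriv l (fun s : ℝ => Real.exp (-s ^ 2)) =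
      fun t => p.eval t * Real.exp (-t ^ 2) := by
    induction l with
    | zero => exact ⟨1, by simp⟩
    | succ l ih =>
      obtain ⟨p, hp⟩ := ih
      refine ⟨Polynomial.derivative p - 2 * Polynomial.X * p, ?_⟩
      rw [iteratedDeriv_succ, hp]
      funext t
      have h1 : HasDerivAt (fun t : ℝ => Real.exp (-t ^ 2))
          (Real.exp (-t ^ 2) * (-(2 * t))) t := by
        have := ((hasDerivAt_pow 2 t).neg).exp
        simpa using this
      have h2 := (p.hasDerivAt t).mul h1
      refine h2.deriv.trans ?_
      simp
      ring
  obtain ⟨p, hp⟩ := key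
  refine ⟨p, fun t => ?_⟩
  rw [hermite1, hp]
  have : Real.exp (-(t ^ 2) / 2) = Real.exp (t ^ 2 / 2) * Real.exp (-t ^ 2) := by
    rw [← Real.exp_add]; congr 1; ring
  rw [this]; ring

theorem continuous_hermite1 (l : ℕ) : Continuous (hermite1 l) := by
  obtain ⟨p, hp⟩ := exists_hermite1_eq l
  rw [funext hp]
  fun_prop

theorem integrable_hermite1_sq (l : ℕ) : Integrable (fun t => hermite1 l t ^ 2) := by
  obtain ⟨p, hp⟩ := exists_hermite1_eq l
  have h1 : ∀ q : Polynomial ℝ, Integrable (fun t : ℝ => q.eval t * Real.exp (-1 * t ^ 2)) := by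
    intro q
    induction q using Polynomial.induction_on' with
    | add a b ha hb =>
      refine (ha.add hb).congr (Filter.Eventually.of_forall fun t => ?_)
      simp [add_mul]
    | monomial k c =>
      have := (integrable_rpow_mul_exp_neg_mul_sq (b := 1) one_pos
        (s := (k : ℝ)) (by have : (0 : ℝ) ≤ k := k.cast_nonneg; linarith)).const_mul c
      simpa [mul_assoc] using this
  refine (h1 (p ^ 2)).congr (Filter.Eventually.of_forall fun t => ?_)
  simp only [hp, mul_pow, Polynomial.eval_pow, ← Real.exp_nat_mul]
  congr 2
  push_cast
  ring

theorem memLp_hermiteFun {n : ℕ} (α : Fin n → ℕ) :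
    MemLp (hermiteFun α) 2 (volume : Measure (EuclideanSpace ℝ (Fin n))) := by
  have hc : Continuous (hermiteFun α) := by
    unfold hermiteFun
    refine Complex.continuous_ofReal.comp (continuous_finsetProd _ fun j _ => ?_)
    exact (continuous_hermite1 (α j)).comp (by fun_prop)
  rw [memLp_two_iff_integrable_sq_norm hc.aestronglyMeasurable]
  have h1 : Integrable (fun y : Fin n → ℝ => ∏ j, hermite1 (α j) (y j) ^ 2) :=
    Integrable.fintype_prod fun j => integrable_hermite1_sq (α j)
  have h2 := (PiLp.volume_preserving_ofLp (Fin n)).integrable_comp_of_integrable h1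
  refine h2.congr (Filter.Eventually.of_forall fun x => ?_)
  have h3 : ‖hermiteFun α x‖ ^ 2 = ∏ j, hermite1 (α j) (x j) ^ 2 := by
    unfold hermiteFun
    rw [Complex.norm_real, Real.norm_eq_abs, sq_abs, ← Finset.prod_pow]
  exact h3.symm

/-- The Hermite function `h_α` as an element of `L²(ℝⁿ)`. -/
def hermiteL2 {n : ℕ} (α : Fin n → ℕ) : L2 n := (memLp_hermiteFun α).toLp

/-- The span `𝔚_l` of the Hermite functions of total degree `l`. -/
def W (n l : ℕ) : Submodule ℂ (L2 n) :=
  Submodule.span ℂ {f | ∃ α : Fin n → ℕ, ∑ j, α j = l ∧ f = hermiteL2 α}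

/-- The restriction of a unitary representation to an invariant subspace. -/
def restrictRep {K V : Type*} [Group K] [NormedAddCommGroup V] [InnerProductSpace ℂ V]
    (u : K →* (V ≃ₗᵢ[ℂ] V)) (S : Submodule ℂ V) (hS : ∀ k, ∀ w ∈ S, u k w ∈ S) :
    K →* (S ≃ₗᵢ[ℂ] S) where
  toFun k :=
    { toFun := fun w => ⟨u k w, hS k w w.2⟩
      invFun := fun w => ⟨u k⁻¹ w, hS k⁻¹ w w.2⟩
      map_add' := fun a b => Subtype.ext (by simp)
      map_smul' := fun a b => Subtype.ext (by simp)
      left_inv := fun w => Subtype.ext (by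
        change u k⁻¹ (u k w) = w
        rw [map_inv]; exact (u k).symm_apply_apply _)
      right_inv := fun w => Subtype.ext (by
        change u k (u k⁻¹ w) = w
        rw [map_inv]; exact (u k).apply_symm_apply _)
      norm_map' := fun w => (u k).norm_map w }
  map_one' := by ext w; simp
  map_mul' a b := by ext w; simp

@[simp] theorem coe_restrictRep {K V : Type*} [Group K] [NormedAddCommGroup V]
    [InnerProductSpace ℂ V] (u : K →* (V ≃ₗᵢ[ℂ] V)) (S : Submodule ℂ V)
    (hS : ∀ k, ∀ w ∈ S, u k w ∈ S) (k : K) (w : S) :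
    ((restrictRep u S hS k w : S) : V) = u k w := rfl

end Hermite

/-! ## Associated Hilbert bundles -/

section Assoc

variable {G : Type*} [Group G] {H : Subgroup G}
  {V : Type*} [NormedAddCommGroup V] [InnerProductSpace ℂ V]
  {V' : Type*} [NormedAddCommGroup V'] [InnerProductSpace ℂ V']

/-- The equivalence relation `(g h, f) ∼ (g, lam(h) f)` on `G × V`. -/
def assocSetoid (lam : H →* (V ≃ₗᵢ[ℂ] V)) : Setoid (G × V) where
  r p q := ∃ h : H, q.1 = p.1 * h ∧ p.2 = lam h q.2
  iseqv :=
    { refl := fun p => ⟨1, by simp, by simp⟩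
      symm := by
        rintro p q ⟨h, h1, h2⟩
        refine ⟨h⁻¹, by simp [h1], ?_⟩
        rw [h2, map_inv]
        exact ((lam h).symm_apply_apply _).symm
      trans := by
        rintro p q r ⟨h, h1, h2⟩ ⟨k, k1, k2⟩
        exact ⟨h * k, by simp [k1, h1, mul_assoc], by simp [h2, k2]⟩ }

/-- The total space of the associated bundle `G ×_lam V` over `G ⧸ H`. -/
def Assoc (lam : H →* (V ≃ₗᵢ[ℂ] V)) : Type _ := Quotient (assocSetoid lam)

namespace Assoc

/-- The class `[g, f]` of a pair `(g, f)`. -/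
def mk (lam : H →* (V ≃ₗᵢ[ℂ] V)) (g : G) (f : V) : Assoc lam := Quotient.mk (assocSetoid lam) (g, f)

/-- The total space carries the quotient topology. -/
instance [TopologicalSpace G] (lam : H →* (V ≃ₗᵢ[ℂ] V)) : TopologicalSpace (Assoc lam) :=
  inferInstanceAs (TopologicalSpace (Quotient (assocSetoid lam)))

/-- The bundle projection `[g, f] ↦ g H`. -/
def proj (lam : H →* (V ≃ₗᵢ[ℂ] V)) : Assoc lam → G ⧸ H :=
  Quotient.lift (fun p : G × V => (p.1 : G ⧸ H)) (by
    rintro p q ⟨h, h1, -⟩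
    refine QuotientGroup.eq.2 ?_
    simp [h1])

theorem mk_mul (lam : H →* (V ≃ₗᵢ[ℂ] V)) (g : G) (h : H) (f : V) :
    mk lam (g * h) f = mk lam g (lam h f) :=
  (Quotient.sound (s := assocSetoid lam) ⟨h, rfl, rfl⟩ :
    Quotient.mk (assocSetoid lam) (g, lam h f) = Quotient.mk (assocSetoid lam) (g * h, f)).symm

/-- The fibre of `G ×_lam V` over a point. -/
def Fibre (lam : H →* (V ≃ₗᵢ[ℂ] V)) (x : G ⧸ H) : Type _ := {q : Assoc lam // proj lam q = x}

/-- The point of the total space given by an element of a fibre. -/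
def Fibre.val {lam : H →* (V ≃ₗᵢ[ℂ] V)} {x : G ⧸ H} (q : Fibre lam x) : Assoc lam := Subtype.val q

/-- The bijection `f ↦ [g, f]` from `V` onto the fibre over `g H`. -/
def fibreEquiv (lam : H →* (V ≃ₗᵢ[ℂ] V)) (x : G ⧸ H) (g : G) (hg : (g : G ⧸ H) = x) :
    V ≃ Fibre lam x :=
  Equiv.ofBijective (fun f => (⟨mk lam g f, hg⟩ : Fibre lam x)) (by
    constructor
    · intro a b hab
      obtain ⟨h, h1, h2⟩ := Quotient.exact (s := assocSetoid lam) (congrArg Fibre.val hab)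
      have h3 : h = 1 := Subtype.ext (by simpa using h1)
      simpa [h3] using h2
    · rintro ⟨q, hq⟩
      obtain ⟨⟨k, f⟩, rfl⟩ := Quotient.exists_rep (s := assocSetoid lam) q
      have h1 : (g : G ⧸ H) = (k : G ⧸ H) := hg.trans hq.symm
      refine ⟨lam ⟨g⁻¹ * k, QuotientGroup.eq.1 h1⟩ f, Subtype.ext ?_⟩
      change mk lam g _ = mk lam k f
      rw [← mk_mul]
      simp)

@[simp] theorem fibreEquiv_val (lam : H →* (V ≃ₗᵢ[ℂ] V)) (x : G ⧸ H) (g : G)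
    (hg : (g : G ⧸ H) = x) (f : V) : (fibreEquiv lam x g hg f).val = mk lam g f := rfl

theorem fibreEquiv_mul (lam : H →* (V ≃ₗᵢ[ℂ] V)) (x : G ⧸ H) (g k : G)
    (hg : (g : G ⧸ H) = x) (hk : (k : G ⧸ H) = x) (f : V) :
    fibreEquiv lam x k hk f =
      fibreEquiv lam x g hg (lam ⟨g⁻¹ * k, QuotientGroup.eq.1 (hg.trans hk.symm)⟩ f) := by
  refine Subtype.ext ?_
  change mk lam k f = mk lam g _
  rw [← mk_mul]
  simp

/-- A reference identification of the fibre over `x` with `V`. By `fibreIsometry` below, the Hilbert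
space structure it induces on the fibre does not depend on the choice of the representative. -/
def refEquiv (lam : H →* (V ≃ₗᵢ[ℂ] V)) (x : G ⧸ H) : Fibre lam x ≃ V :=
  (fibreEquiv lam x (Quotient.out x) (QuotientGroup.out_eq' x)).symm

instance (lam : H →* (V ≃ₗᵢ[ℂ] V)) (x : G ⧸ H) : AddCommGroup (Fibre lam x) :=
  (refEquiv lam x).addCommGroup

instance (lam : H →* (V ≃ₗᵢ[ℂ] V)) (x : G ⧸ H) : Module ℂ (Fibre lam x) :=
  (refEquiv lam x).module ℂ

/-- The reference identification as a linear map. -/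
def refLinear (lam : H →* (V ≃ₗᵢ[ℂ] V)) (x : G ⧸ H) : Fibre lam x ≃ₗ[ℂ] V :=
  (refEquiv lam x).linearEquiv ℂ

instance (lam : H →* (V ≃ₗᵢ[ℂ] V)) (x : G ⧸ H) : NormedAddCommGroup (Fibre lam x) :=
  NormedAddCommGroup.induced _ _ (refLinear lam x) (refLinear lam x).injective

/-- The fibre metric `⟨[g, f₁], [g, f₂]⟩ = ⟨f₁, f₂⟩`. -/
instance (lam : H →* (V ≃ₗᵢ[ℂ] V)) (x : G ⧸ H) : InnerProductSpace ℂ (Fibre lam x) where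
  norm_smul_le c q := by
    change ‖refLinear lam x (c • q)‖ ≤ ‖c‖ * ‖refLinear lam x q‖
    rw [map_smul, norm_smul]
  inner p q := inner ℂ (refLinear lam x p) (refLinear lam x q)
  norm_sq_eq_re_inner q := norm_sq_eq_re_inner (𝕜 := ℂ) (refLinear lam x q)
  conj_inner_symm p q := inner_conj_symm _ _
  add_left p q r := by
    change inner ℂ (refLinear lam x (p + q)) _ = _
    rw [map_add, inner_add_left]
  smul_left p q c := by
    change inner ℂ (refLinear lam x (c • p)) _ = _
    rw [map_smul, inner_smul_left]

/-- The reference identification as a linear isometry. -/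
def refIsometry (lam : H →* (V ≃ₗᵢ[ℂ] V)) (x : G ⧸ H) : Fibre lam x ≃ₗᵢ[ℂ] V where
  toLinearEquiv := refLinear lam x
  norm_map' _ := rfl

instance [CompleteSpace V] (lam : H →* (V ≃ₗᵢ[ℂ] V)) (x : G ⧸ H) : CompleteSpace (Fibre lam x) :=
  (refIsometry lam x).symm.isometry.isUniformInducing.completeSpace_congr
    (refIsometry lam x).symm.surjective |>.1 inferInstance

/-- For every representative `g` of the point `x`, the map `f ↦ [g, f]` is a linear isometry
from `V` onto the fibre over `x`. -/
def fibreIsometry (lam : H →* (V ≃ₗᵢ[ℂ] V)) (x : G ⧸ H) (g : G) (hg : (g : G ⧸ H) = x) :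
    V ≃ₗᵢ[ℂ] Fibre lam x :=
  (lam ⟨(Quotient.out x)⁻¹ * g,
    QuotientGroup.eq.1 ((QuotientGroup.out_eq' x).trans hg.symm)⟩).trans (refIsometry lam x).symm

theorem fibreIsometry_apply (lam : H →* (V ≃ₗᵢ[ℂ] V)) (x : G ⧸ H) (g : G)
    (hg : (g : G ⧸ H) = x) (f : V) : (fibreIsometry lam x g hg f).val = mk lam g f := by
  rw [← fibreEquiv_val lam x g hg,
    fibreEquiv_mul lam x (Quotient.out x) g (QuotientGroup.out_eq' x) hg]
  rfl

/-- The bundle map `[g, f] ↦ [g, j f]` induced by an equivariant map `j`. -/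
def map {lam' : H →* (V' ≃ₗᵢ[ℂ] V')} {lam : H →* (V ≃ₗᵢ[ℂ] V)} (j : V' →ₗᵢ[ℂ] V)
    (hj : ∀ h f, j (lam' h f) = lam h (j f)) : Assoc lam' → Assoc lam :=
  Quotient.map (sa := assocSetoid lam') (sb := assocSetoid lam) (fun p => (p.1, j p.2)) (by
    rintro p q ⟨h, h1, h2⟩
    exact ⟨h, h1, by simp [h2, hj]⟩)

theorem proj_map {lam' : H →* (V' ≃ₗᵢ[ℂ] V')} {lam : H →* (V ≃ₗᵢ[ℂ] V)} (j : V' →ₗᵢ[ℂ] V)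
    (hj : ∀ h f, j (lam' h f) = lam h (j f)) (q : Assoc lam') :
    proj lam (map j hj q) = proj lam' q := by
  obtain ⟨p, rfl⟩ := Quotient.exists_rep (s := assocSetoid lam') q
  rfl

/-- The map between the fibres over `x` that is induced by an equivariant isometry `j`. -/
def fibreMap {lam' : H →* (V' ≃ₗᵢ[ℂ] V')} {lam : H →* (V ≃ₗᵢ[ℂ] V)} (j : V' →ₗᵢ[ℂ] V)
    (_hj : ∀ h f, j (lam' h f) = lam h (j f)) (x : G ⧸ H) : Fibre lam' x →ₗᵢ[ℂ] Fibre lam x :=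
  (refIsometry lam x).symm.toLinearIsometry.comp (j.comp (refIsometry lam' x).toLinearIsometry)

theorem fibreMap_val {lam' : H →* (V' ≃ₗᵢ[ℂ] V')} {lam : H →* (V ≃ₗᵢ[ℂ] V)} (j : V' →ₗᵢ[ℂ] V)
    (hj : ∀ h f, j (lam' h f) = lam h (j f)) (x : G ⧸ H) (q : Fibre lam' x) :
    (fibreMap j hj x q).val = map j hj q.val := by
  obtain ⟨f, rfl⟩ := (refIsometry lam' x).symm.surjective q
  change ((refIsometry lam x).symm (j (refIsometry lam' x ((refIsometry lam' x).symm f)))).val = _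
  rw [LinearIsometryEquiv.apply_symm_apply]
  rfl

/-- A local trivialization of `G ×_lam V` is unitary if it is a linear isometry onto `V` on each
fibre. -/
def IsUnitaryTrivialization [TopologicalSpace G] {lam : H →* (V ≃ₗᵢ[ℂ] V)}
    (t : Bundle.Trivialization V (proj lam)) : Prop :=
  ∀ x ∈ t.baseSet, ∃ T : Fibre lam x ≃ₗᵢ[ℂ] V, ∀ q : Fibre lam x, t q.val = (x, T q)

end Assoc

end Assoc

/-! ## Hermitian symmetric spaces -/

section Symmetric

variable {E : Type*} [NormedAddCommGroup E] [NormedSpace ℝ E]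
  {G : Type*} [TopologicalSpace G] [ChartedSpace E G] [Group G]
  {F : Type*} [NormedAddCommGroup F] [NormedSpace ℝ F]

/-- The adjoint representation of `G` on its Lie algebra: the derivative at the unit element of the
conjugation `x ↦ g x g⁻¹`. -/
def Ad (g : G) (X : GroupLieAlgebra 𝓘(ℝ, E) G) : GroupLieAlgebra 𝓘(ℝ, E) G :=
  mfderiv 𝓘(ℝ, E) 𝓘(ℝ, E) (fun x : G => g * x * g⁻¹) 1 X

variable (E F) in
/-- The Lie algebra of a Lie subgroup `H`, as a subspace of the Lie algebra of `G`. -/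
def lieSubalg (H : Subgroup G) [ChartedSpace F H] :
    Submodule ℝ (GroupLieAlgebra 𝓘(ℝ, E) G) :=
  LinearMap.range
    ((mfderiv 𝓘(ℝ, F) 𝓘(ℝ, E) (Subtype.val : H → G) 1 :
      GroupLieAlgebra 𝓘(ℝ, F) H →L[ℝ] GroupLieAlgebra 𝓘(ℝ, E) G) :
      GroupLieAlgebra 𝓘(ℝ, F) H →ₗ[ℝ] GroupLieAlgebra 𝓘(ℝ, E) G)

variable (E F) in
/-- The infinitesimal data of a Hermitian symmetric space `G ⧸ H`. -/
structure HermitianSymmetricData (H : Subgroup G) [ChartedSpace F H] where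
  /-- The complement of the isotropy algebra. -/
  m : Submodule ℝ (GroupLieAlgebra 𝓘(ℝ, E) G)
  isCompl : IsCompl (lieSubalg E F H) m
  bracket_h_m : ∀ Z ∈ lieSubalg E F H, ∀ X ∈ m, ⁅Z, X⁆ ∈ m
  bracket_m_m : ∀ X ∈ m, ∀ Y ∈ m, ⁅X, Y⁆ ∈ lieSubalg E F H
  /-- The symplectic form on `m`. -/
  omega : m →ₗ[ℝ] m →ₗ[ℝ] ℝ
  omega_skew : ∀ X Y, omega X Y = - omega Y X
  omega_nondegenerate : ∀ X, (∀ Y, omega X Y = 0) → X = 0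
  omega_invariant : ∀ (Z : GroupLieAlgebra 𝓘(ℝ, E) G) (hZ : Z ∈ lieSubalg E F H) (X Y : m),
    omega ⟨⁅Z, (X : GroupLieAlgebra 𝓘(ℝ, E) G)⁆, bracket_h_m Z hZ X X.2⟩ Y +
      omega X ⟨⁅Z, (Y : GroupLieAlgebra 𝓘(ℝ, E) G)⁆, bracket_h_m Z hZ Y Y.2⟩ = 0
  /-- The complex structure on `m`. -/
  cplx : m →ₗ[ℝ] m
  cplx_cplx : ∀ X, cplx (cplx X) = -X
  cplx_invariant : ∀ (Z : GroupLieAlgebra 𝓘(ℝ, E) G) (hZ : Z ∈ lieSubalg E F H) (X : m),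
    cplx ⟨⁅Z, (X : GroupLieAlgebra 𝓘(ℝ, E) G)⁆, bracket_h_m Z hZ X X.2⟩ =
      ⟨⁅Z, (cplx X : GroupLieAlgebra 𝓘(ℝ, E) G)⁆, bracket_h_m Z hZ (cplx X) (cplx X).2⟩
  metric_symm : ∀ X Y, omega X (cplx Y) = omega Y (cplx X)
  metric_pos : ∀ X, X ≠ 0 → 0 < omega X (cplx X)

namespace HermitianSymmetricData

variable {H : Subgroup G} [ChartedSpace F H]

/-- A unitary basis `(X₁, …, X₂ₙ)` of `m`, i.e. a symplectic basis with `J₀ Xⱼ = Xₙ₊ⱼ`; the index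
`Sum.inl j` stands for `j` and `Sum.inr j` for `n + j`. -/
structure IsUnitaryBasis (D : HermitianSymmetricData E F H) {n : ℕ}
    (X : Module.Basis (Fin n ⊕ Fin n) ℝ D.m) : Prop where
  omega_inl_inl : ∀ j k, D.omega (X (Sum.inl j)) (X (Sum.inl k)) = 0
  omega_inr_inr : ∀ j k, D.omega (X (Sum.inr j)) (X (Sum.inr k)) = 0
  omega_inl_inr : ∀ j k, D.omega (X (Sum.inl j)) (X (Sum.inr k)) = if j = k then 1 else 0
  cplx_inl : ∀ j, D.cplx (X (Sum.inl j)) = X (Sum.inr j)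

/-- `kap` is a lift to `Mp(n, ℝ)` of the isotropy representation of `H` on `m`: it is a
continuous homomorphism, and `ρ(kap(h))` is the matrix of `Ad(h)` on `m` in the basis `X`. -/
structure IsLift (D : HermitianSymmetricData E F H) {n : ℕ}
    (X : Module.Basis (Fin n ⊕ Fin n) ℝ D.m) (kap : H →* Mp n) : Prop where
  continuous : Continuous kap
  rho_eq : ∀ (h : H) (j : Fin n ⊕ Fin n),
    Ad (h : G) (X j : GroupLieAlgebra 𝓘(ℝ, E) G) =
      ∑ i, ((Mp.rho (kap h) : symplecticGroup (Fin n) ℝ) :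
        Matrix (Fin n ⊕ Fin n) (Fin n ⊕ Fin n) ℝ) i j • (X i : GroupLieAlgebra 𝓘(ℝ, E) G)

end HermitianSymmetricData

end Symmetric

/-! ## The symplectic spinor bundle and its pieces -/

section Spinor

variable {G : Type*} [Group G] {H : Subgroup G} {n : ℕ}

/-- The representation `lam` of `H` on `L²(ℝⁿ)`: the metaplectic representation composed with the
lift. The symplectic spinor bundle is `Assoc (spinorRep kap)`. -/
def spinorRep (kap : H →* Mp n) : H →* (L2 n ≃ₗᵢ[ℂ] L2 n) := Mp.rep.comp kap

/-- The restriction `u` of the metaplectic representation to `Û(n)`. -/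
def unitaryRep (n : ℕ) : UHat n →* (L2 n ≃ₗᵢ[ℂ] L2 n) := Mp.rep.comp (UHat n).subtype

/-- The representation `lam_l` of `H` on `𝔚_l`: the restriction `u_l` of `u` to `𝔚_l`, composed with
the lift. The bundle `Q_l` is `Assoc (spinorRepW kap hU hW l)`. -/
def spinorRepW (kap : H →* Mp n) (hU : ∀ h, kap h ∈ UHat n)
    (hW : ∀ l (q : UHat n), ∀ w ∈ W n l, unitaryRep n q w ∈ W n l) (l : ℕ) :
    H →* (W n l ≃ₗᵢ[ℂ] W n l) :=
  (restrictRep (unitaryRep n) (W n l) (hW l)).comp (kap.codRestrict (UHat n) hU)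

theorem spinorRepW_equivariant (kap : H →* Mp n) (hU : ∀ h, kap h ∈ UHat n)
    (hW : ∀ l (q : UHat n), ∀ w ∈ W n l, unitaryRep n q w ∈ W n l) (l : ℕ) (h : H) (w : W n l) :
    (W n l).subtypeₗᵢ (spinorRepW kap hU hW l h w) = spinorRep kap h ((W n l).subtypeₗᵢ w) := rfl

/-- The inclusion `Q_l → Q`, `[g, w] ↦ [g, w]`. -/
def inclQ (kap : H →* Mp n) (hU : ∀ h, kap h ∈ UHat n)
    (hW : ∀ l (q : UHat n), ∀ w ∈ W n l, unitaryRep n q w ∈ W n l) (l : ℕ) :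
    Assoc (spinorRepW kap hU hW l) → Assoc (spinorRep kap) :=
  Assoc.map (W n l).subtypeₗᵢ (spinorRepW_equivariant kap hU hW l)

/-- The inclusion of the fibre of `Q_l` over `x` into the fibre of `Q` over `x`. -/
def inclQFibre (kap : H →* Mp n) (hU : ∀ h, kap h ∈ UHat n)
    (hW : ∀ l (q : UHat n), ∀ w ∈ W n l, unitaryRep n q w ∈ W n l) (x : G ⧸ H) (l : ℕ) :
    Assoc.Fibre (spinorRepW kap hU hW l) x →ₗᵢ[ℂ] Assoc.Fibre (spinorRep kap) x :=
  Assoc.fibreMap (W n l).subtypeₗᵢ (spinorRepW_equivariant kap hU hW l) x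

end Spinor

end SymplecticSpinor

end

/-! Three facts carry the theorem: `L²(ℝⁿ)` is the Hilbert sum of the `𝔚_l`, each invariant under
`Û(n)`; `kap` takes values in `Û(n)`; and `G → G ⧸ H` has continuous local sections.

Invariance is proved with matrix coefficients against displaced Gaussians instead of the
infinitesimal harmonic oscillator. For `w = h_α` and `v = (a, b)`, the function `v ↦ ⟪w, r(v) h₀⟫
exp (v·v / 4)` is a constant times `∏ (bⱼ - i aⱼ) ^ αⱼ`, hence homogeneous of degree `|α|`
(`inner_weyl_smul`). As the Hermite functions are complete and the displaced Gaussians total, this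
homogeneity characterizes `𝔚_l` (`mem_W_of_inner_weyl_smul`). A unitary operator `U` implementing an
orthogonal matrix `A` preserves the expectations `⟪h₀, r(v) h₀⟫`, which depend only on `v·v`. This
forces `U h₀ = c h₀` (`exists_eq_smul_of_inner_weyl_eq`), so the coefficients of `U w` are those of
`w` composed with `Aᵀ`, up to a scalar, and stay homogeneous of the same degree (`map_mem_W`).

For the lift: the derivative of `Ad` is the bracket (`exists_hasMFDerivAt_Ad`), and `ad Z` with `Z ∈
𝔥` is skew for the metric `ω₀(·, J₀ ·)` because `ω₀` and `J₀` are invariant. Since `H` is connected,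
`Ad(h)` on `𝔪` is orthogonal (`mul_transpose_eq_one_of_skew`); an orthogonal symplectic matrix
commutes with `J`.

For the bundles: a slice transversal to `H`, found with the inverse function theorem, gives local
sections (`exists_section`). One section trivializes `Q` and all `Q_l` simultaneously, because the
lift is strongly continuous and the inclusions are equivariant. Equivariance of the orthogonal
projections onto `𝔚_l` makes the inclusions closed embeddings (`isClosedEmbedding_inclQ`). -/

noncomputable section

namespace SymplecticSpinor

open scoped FourierTransform InnerProductSpace

/-! ### Injectivity of the Fourier transform on integrable functions -/

section FourierInjective

variable {V : Type*} [NormedAddCommGroup V] [InnerProductSpace ℝ V] [FiniteDimensional ℝ V]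
  [MeasurableSpace V] [BorelSpace V]

/-- The Fourier transform is injective on integrable functions. -/
theorem ae_eq_zero_of_fourier_eq_zero {k : V → ℂ} (hk : Integrable k) (h : ∀ w, 𝓕 k w = 0) :
    k =ᵐ[volume] 0 := by
  refine ae_eq_zero_of_integral_contDiff_smul_eq_zero hk.locallyIntegrable fun g hg hgc => ?_
  have hc : HasCompactSupport (fun x => (g x : ℂ)) := hgc.comp_left (g := Complex.ofReal) rfl
  have hs : ContDiff ℝ ∞ (fun x => (g x : ℂ)) := Complex.ofRealCLM.contDiff.comp hg
  set φ : SchwartzMap V ℂ := hc.toSchwartzMap hs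
  -- A test function is the Fourier transform of a Schwartz function, and the transform can be moved
  -- onto `k` under the integral, where it vanishes.
  have h1 : (𝓕 (𝓕⁻ φ) : SchwartzMap V ℂ) = φ := FourierTransform.fourier_fourierInv_eq φ
  have h2 := VectorFourier.integral_fourierIntegral_smul_eq_flip (μ := volume) (ν := volume)
    (L := innerₗ V) (f := (𝓕⁻ φ : SchwartzMap V ℂ)) (g := k) Real.continuous_fourierChar
    continuous_inner (SchwartzMap.integrable _) hk
  have h3 : ∀ x, VectorFourier.fourierIntegral 𝐞 volume (innerₗ V).flip k x = 0 := by
    intro x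
    rw [flip_innerₗ]
    exact h x
  have h4 : ∀ x, VectorFourier.fourierIntegral 𝐞 volume (innerₗ V)
      (𝓕⁻ φ : SchwartzMap V ℂ) x = g x := by
    intro x
    change 𝓕 ((𝓕⁻ φ : SchwartzMap V ℂ) : V → ℂ) x = g x
    rw [← SchwartzMap.fourier_coe, h1]
    rfl
  simp only [h3, h4, smul_zero, integral_zero] at h2
  simpa using h2

/-- An integrable function is almost everywhere zero if all the integrals
`∫ exp (i ⟨a, x⟩) k x` vanish. -/
theorem ae_eq_zero_of_integral_exp_inner_eq_zero {k : V → ℂ} (hk : Integrable k)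
    (h : ∀ a : V, ∫ x, Complex.exp (Complex.I * (⟪a, x⟫_ℝ : ℝ)) * k x = 0) :
    k =ᵐ[volume] 0 := by
  refine ae_eq_zero_of_fourier_eq_zero hk fun w => ?_
  rw [Real.fourier_eq', ← h (-(2 * Real.pi) • w)]
  refine integral_congr_ae (Filter.Eventually.of_forall fun x => ?_)
  simp only [smul_eq_mul, inner_smul_left, real_inner_comm]
  congr 2
  push_cast
  simp
  ring

end FourierInjective

/-! ### Hermite functions of one variable -/

section HermiteOneVariable

open Polynomial in
/-- The Hermite polynomials, normalized by `(d/dt)^k exp (- t²) = H_k(t) exp (- t²)`. -/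
def hermitePoly : ℕ → Polynomial ℝ
  | 0 => 1
  | k + 1 => derivative (hermitePoly k) - 2 * X * hermitePoly k

theorem natDegree_hermitePoly_le (k : ℕ) : (hermitePoly k).natDegree ≤ k := by
  induction k with
  | zero => simp [hermitePoly]
  | succ k ih =>
    refine (Polynomial.natDegree_sub_le _ _).trans (max_le ?_ ?_)
    · exact (Polynomial.natDegree_derivative_le _).trans (by omega)
    · refine Polynomial.natDegree_mul_le.trans ?_
      have : (2 * Polynomial.X : Polynomial ℝ).natDegree ≤ 1 := by
        refine Polynomial.natDegree_mul_le.trans ?_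
        simp
      omega

-- Induction: differentiate the defining recursion and use the recursion once more to eliminate the
-- derivative of the lower polynomial. This lowering relation turns the recursion into the
-- three-term recurrence `mul_hermite1`.
open Polynomial in
theorem derivative_hermitePoly_succ (k : ℕ) :
    derivative (hermitePoly (k + 1)) = -(2 * (k + 1 : Polynomial ℝ)) * hermitePoly k := by
  induction k with
  | zero => simp [hermitePoly, derivative_mul]
  | succ k ih =>
    have h1 : hermitePoly (k + 2) =
      derivative (hermitePoly (k + 1)) - 2 * X * hermitePoly (k + 1) := rfl
    have h2 : derivative (hermitePoly k) = hermitePoly (k + 1) + 2 * X * hermitePoly k := by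
      rw [hermitePoly]; ring
    rw [h1, derivative_sub, ih]
    simp only [derivative_mul, derivative_neg, derivative_add, derivative_natCast, derivative_one,
      derivative_ofNat, derivative_X, ih, h2]
    push_cast
    ring

theorem iteratedDeriv_exp_neg_sq (k : ℕ) :
    iteratedDeriv k (fun s : ℝ => Real.exp (-s ^ 2)) =
      fun t => (hermitePoly k).eval t * Real.exp (-t ^ 2) := by
  induction k with
  | zero => simp [hermitePoly]
  | succ k ih =>
    rw [iteratedDeriv_succ, ih]
    funext t
    have h1 : HasDerivAt (fun t : ℝ => Real.exp (-t ^ 2)) (Real.exp (-t ^ 2) * (-(2 * t))) t := by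
      simpa using ((hasDerivAt_pow 2 t).neg).exp
    refine (((hermitePoly k).hasDerivAt t).mul h1).deriv.trans ?_
    simp [hermitePoly]
    ring

theorem hermite1_eq (k : ℕ) (t : ℝ) :
    hermite1 k t = (hermitePoly k).eval t * Real.exp (-(t ^ 2) / 2) := by
  have : Real.exp (-(t ^ 2) / 2) = Real.exp (t ^ 2 / 2) * Real.exp (-t ^ 2) := by
    rw [← Real.exp_add]; congr 1; ring
  rw [hermite1, iteratedDeriv_exp_neg_sq, this]
  ring

theorem hermite1_zero (t : ℝ) : hermite1 0 t = Real.exp (-(t ^ 2) / 2) := by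
  simp [hermite1_eq, hermitePoly]

/-- The three-term recurrence of the Hermite functions. -/
theorem mul_hermite1 (k : ℕ) (t : ℝ) :
    t * hermite1 k t = -k * hermite1 (k - 1) t - 2⁻¹ * hermite1 (k + 1) t := by
  simp only [hermite1_eq]
  have h1 : (hermitePoly (k + 1)).eval t =
      (Polynomial.derivative (hermitePoly k)).eval t - 2 * t * (hermitePoly k).eval t := by
    simp [hermitePoly]
  have h2 : (Polynomial.derivative (hermitePoly k)).eval t =
      -(2 * k) * (hermitePoly (k - 1)).eval t := by
    -- For `k = 0` the truncated index `k - 1` is harmless, since its coefficient vanishes.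
    cases k with
    | zero => simp [hermitePoly]
    | succ k => simp [derivative_hermitePoly_succ]
  rw [h1, h2]
  ring

theorem integrable_pow_mul_cexp (k : ℕ) (c : ℂ) :
    Integrable fun t : ℝ => (t : ℂ) ^ k * Complex.exp (c * t) * Real.exp (-t ^ 2) := by
  -- The majorant comes from `|t| ^ k ≤ k! exp |t|` and `(‖c‖ + 1) |t| ≤ (‖c‖ + 1)² / 2 + t² / 2`,
  -- which uses up half of the Gaussian exponent.
  have h0 := ((integrable_exp_neg_mul_sq (b := 2⁻¹) (by norm_num)).const_mul
    (k.factorial * Real.exp ((‖c‖ + 1) ^ 2 / 2)))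
  refine h0.mono' (by fun_prop) (Filter.Eventually.of_forall fun t => ?_)
  have h1 : |t| ^ k ≤ k.factorial * Real.exp |t| := by
    have := Real.pow_div_factorial_le_exp |t| (abs_nonneg t) k
    rwa [div_le_iff₀ (by positivity), mul_comm] at this
  have h2 : ‖Complex.exp (c * t)‖ ≤ Real.exp (‖c‖ * |t|) := by
    refine (Complex.norm_exp_le_exp_norm _).trans ?_
    rw [norm_mul, Complex.norm_real, Real.norm_eq_abs]
  rw [norm_mul, norm_mul, norm_pow, Complex.norm_real, Complex.norm_real, Real.norm_eq_abs,
    Real.norm_eq_abs, Real.abs_exp]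
  calc |t| ^ k * ‖Complex.exp (c * t)‖ * Real.exp (-t ^ 2)
      ≤ (k.factorial * Real.exp |t|) * Real.exp (‖c‖ * |t|) * Real.exp (-t ^ 2) := by gcongr
    _ = k.factorial * Real.exp ((‖c‖ + 1) * |t| - |t| ^ 2) := by
        rw [mul_assoc, mul_assoc, ← Real.exp_add, ← Real.exp_add, sq_abs]
        ring_nf
    _ ≤ k.factorial * Real.exp ((‖c‖ + 1) ^ 2 / 2 + (-2⁻¹ * t ^ 2)) := by
        gcongr
        rw [← sq_abs t]
        nlinarith [sq_nonneg (‖c‖ + 1 - |t|)]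
    _ = _ := by rw [Real.exp_add, mul_assoc]

theorem integrable_eval_mul_cexp (p : Polynomial ℂ) (c : ℂ) :
    Integrable fun t : ℝ => p.eval (t : ℂ) * Complex.exp (c * t) * Real.exp (-t ^ 2) := by
  induction p using Polynomial.induction_on' with
  | add p q hp hq =>
    refine (hp.add hq).congr (Filter.Eventually.of_forall fun t => ?_)
    simp [add_mul]
  | monomial k z =>
    refine ((integrable_pow_mul_cexp k c).const_mul z).congr
      (Filter.Eventually.of_forall fun t => ?_)
    simp [mul_assoc]

theorem integrable_hermitePoly_mul (k : ℕ) (p : Polynomial ℂ) (c : ℂ) :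
    Integrable fun t : ℝ => (((hermitePoly k).eval t * Real.exp (-t ^ 2) : ℝ) : ℂ) *
      (p.eval (t : ℂ) * Complex.exp (c * t)) := by
  refine (integrable_eval_mul_cexp ((hermitePoly k).map Complex.ofRealHom * p) c).congr
    (Filter.Eventually.of_forall fun t => ?_)
  have : ((hermitePoly k).map Complex.ofRealHom).eval (t : ℂ) =
      (((hermitePoly k).eval t : ℝ) : ℂ) := by
    rw [Polynomial.eval_map, ← Complex.ofRealHom_eq_coe, Polynomial.eval₂_hom]
    rfl
  simp only [Polynomial.eval_mul, this]
  push_cast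
  ring

open Polynomial in
/-- Integration by parts against Hermite polynomials. -/
theorem integral_hermitePoly_mul (k : ℕ) (p : Polynomial ℂ) (c : ℂ) :
    ∫ t : ℝ, (((hermitePoly k).eval t * Real.exp (-t ^ 2) : ℝ) : ℂ) *
      (p.eval (t : ℂ) * Complex.exp (c * t)) =
    ∫ t : ℝ, (Real.exp (-t ^ 2) : ℂ) *
      (((fun q => -(derivative q + C c * q))^[k] p).eval (t : ℂ) * Complex.exp (c * t)) := by
  induction k generalizing p with
  | zero => simp [hermitePoly]
  | succ k ih =>
    rw [Function.iterate_succ_apply, ← ih]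
    -- `H_{k+1} exp (-t²)` is the derivative of `H_k exp (-t²)`, so each integration by parts lowers
    -- `k` by one and applies `q ↦ -(q' + c q)` to the polynomial in front of `exp (c t)`.
    have hu : ∀ t : ℝ, HasDerivAt
        (fun t : ℝ => (((hermitePoly k).eval t * Real.exp (-t ^ 2) : ℝ) : ℂ))
        (((hermitePoly (k + 1)).eval t * Real.exp (-t ^ 2) : ℝ) : ℂ) t := by
      intro t
      have h1 : HasDerivAt (fun t : ℝ => Real.exp (-t ^ 2)) (Real.exp (-t ^ 2) * (-(2 * t))) t := by
        simpa using ((hasDerivAt_pow 2 t).neg).exp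
      have h2 := (((hermitePoly k).hasDerivAt t).mul h1).ofReal_comp
      refine h2.congr_deriv ?_
      congr 1
      simp [hermitePoly]
      ring
    have hv : ∀ t : ℝ, HasDerivAt (fun t : ℝ => p.eval (t : ℂ) * Complex.exp (c * t))
        ((derivative p + C c * p).eval (t : ℂ) * Complex.exp (c * t)) t := by
      intro t
      have h1 : HasDerivAt (fun z : ℂ => p.eval z * Complex.exp (c * z))
          ((derivative p + C c * p).eval (t : ℂ) * Complex.exp (c * t)) (t : ℂ) := by
        refine ((p.hasDerivAt (t : ℂ)).mul
          ((hasDerivAt_id (t : ℂ)).const_mul c).cexp).congr_deriv ?_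
        simp
        ring
      exact h1.comp_ofReal
    have := integral_mul_deriv_eq_deriv_mul_of_integrable (fun t _ => hv t) (fun t _ => hu t)
      ((integrable_hermitePoly_mul (k + 1) p c).congr
        (Filter.Eventually.of_forall fun t => mul_comm _ _))
      ((integrable_hermitePoly_mul k (derivative p + C c * p) c).congr
        (Filter.Eventually.of_forall fun t => mul_comm _ _))
      ((integrable_hermitePoly_mul k p c).congr
        (Filter.Eventually.of_forall fun t => mul_comm _ _))
    simp only [mul_comm _ (((hermitePoly _).eval _ * _ : ℝ) : ℂ)] at this
    rw [this, ← integral_neg]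
    congr 1
    funext t
    simp only [eval_neg]
    ring

/-- The Hermite functions of one variable are pairwise orthogonal. -/
theorem integral_hermite1_mul_hermite1 {j k : ℕ} (hjk : j ≠ k) :
    ∫ t : ℝ, hermite1 j t * hermite1 k t = 0 := by
  wlog h : j < k generalizing j k
  · simp only [mul_comm (hermite1 j _)]
    exact this hjk.symm (by omega)
  -- With `c = 0` all `k` derivatives fall on `H_j`, whose degree is at most `j < k`.
  have h1 := integral_hermitePoly_mul k ((hermitePoly j).map Complex.ofRealHom) 0
  have h2 : ∀ m (q : Polynomial ℂ), (fun q => -(Polynomial.derivative q + Polynomial.C 0 * q))^[m] q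
      = (-1) ^ m * Polynomial.derivative^[m] q := by
    intro m
    induction m with
    | zero => simp
    | succ m ih =>
      intro q
      rw [Function.iterate_succ_apply, Function.iterate_succ_apply, ih]
      simp
      ring
  rw [h2, Polynomial.iterate_derivative_eq_zero ((Polynomial.natDegree_map_le).trans_lt
    ((natDegree_hermitePoly_le j).trans_lt h))] at h1
  simp only [mul_zero, Polynomial.eval_zero, zero_mul, integral_zero] at h1
  rw [← Complex.ofReal_inj, ← integral_complex_ofReal, Complex.ofReal_zero, ← h1]
  congr 1
  funext t
  have h3 : ((hermitePoly j).map Complex.ofRealHom).eval (t : ℂ) =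
      (((hermitePoly j).eval t : ℝ) : ℂ) := by
    rw [Polynomial.eval_map, ← Complex.ofRealHom_eq_coe, Polynomial.eval₂_hom]
    rfl
  have h4 : Real.exp (-t ^ 2) = Real.exp (-(t ^ 2) / 2) * Real.exp (-(t ^ 2) / 2) := by
    rw [← Real.exp_add]; congr 1; ring
  simp only [hermite1_eq, h3, h4]
  simp
  ring

/-- The integral of a Hermite function against a displaced Gaussian. -/
theorem integral_hermite1_mul_displaced (k : ℕ) (a b : ℝ) :
    ∫ t : ℝ, (hermite1 k t : ℂ) * (Complex.exp (Complex.I * (a * (t + b / 2) : ℝ)) *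
      hermite1 0 (t + b)) =
    (Real.pi : ℂ) ^ (1 / 2 : ℂ) * (b - Complex.I * a) ^ k *
      Real.exp (-(a ^ 2 + b ^ 2) / 4) := by
  -- The phase and the two Gaussians have total exponent `-t² + c t + d`. Integrating by parts
  -- against `p = 1` produces `(-c) ^ k = (b - i a) ^ k`, and `d + c² / 4 = -(a² + b²) / 4`.
  set c : ℂ := Complex.I * a - b
  set d : ℂ := Complex.I * a * b / 2 - b ^ 2 / 2
  have h1 := integral_hermitePoly_mul k 1 c
  have h2 : ∀ m, (fun q => -(Polynomial.derivative q + Polynomial.C c * q))^[m]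
      (1 : Polynomial ℂ) = Polynomial.C ((-c) ^ m) := by
    intro m
    induction m with
    | zero => simp
    | succ m ih =>
      rw [Function.iterate_succ_apply', ih]
      simp only [Polynomial.derivative_C, zero_add, ← Polynomial.C_mul, ← Polynomial.C_neg]
      congr 1
      ring
  rw [h2] at h1
  have h3 : ∫ t : ℝ, (Real.exp (-t ^ 2) : ℂ) * Complex.exp (c * t) =
      (Real.pi : ℂ) ^ (1 / 2 : ℂ) * Complex.exp (c ^ 2 / 4) := by
    have := integral_cexp_quadratic (b := -1) (by simp) c 0
    simp only [neg_neg, div_one, zero_sub, mul_neg, mul_one, div_neg, add_zero] at this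
    rw [← this]
    congr 1
    funext t
    push_cast
    rw [← Complex.exp_add]
    congr 1
    ring
  calc ∫ t : ℝ, (hermite1 k t : ℂ) * (Complex.exp (Complex.I * (a * (t + b / 2) : ℝ)) *
        hermite1 0 (t + b))
      = ∫ t : ℝ, Complex.exp d * ((((hermitePoly k).eval t * Real.exp (-t ^ 2) : ℝ) : ℂ) *
          ((1 : Polynomial ℂ).eval (t : ℂ) * Complex.exp (c * t))) := by
        congr 1
        funext t
        rw [hermite1_eq, hermite1_zero]
        push_cast
        simp only [Polynomial.eval_one, one_mul]
        have : Complex.exp (-t ^ 2 / 2) * (Complex.exp (Complex.I * (a * (t + b / 2))) *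
            Complex.exp (-(t + b) ^ 2 / 2)) =
            Complex.exp d * (Complex.exp (-t ^ 2) * Complex.exp (c * t)) := by
          simp only [← Complex.exp_add]
          congr 1
          simp only [c, d]
          ring
        linear_combination (((hermitePoly k).eval t : ℝ) : ℂ) * this
    _ = Complex.exp d * ((-c) ^ k * ((Real.pi : ℂ) ^ (1 / 2 : ℂ) * Complex.exp (c ^ 2 / 4))) := by
        rw [integral_const_mul, h1, ← h3, ← integral_const_mul ((-c) ^ k)]
        congr 2
        funext t
        simp only [Polynomial.eval_C]
        ring
    _ = _ := by
        have h5 : Complex.exp d * Complex.exp (c ^ 2 / 4) =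
            ((Real.exp (-(a ^ 2 + b ^ 2) / 4) : ℝ) : ℂ) := by
          rw [← Complex.exp_add]
          push_cast
          congr 1
          simp only [c, d]
          linear_combination (a ^ 2 / 4 : ℂ) * Complex.I_sq
        rw [← h5]
        have : -c = b - Complex.I * a := by simp only [c]; ring
        rw [this]
        ring

end HermiteOneVariable

/-! ### Hermite functions of several variables and matrix coefficients of the Weyl operators -/

section Hermite

variable {n : ℕ}

/-- Fubini's theorem for products of functions of one coordinate. -/
theorem integral_euclidean_prod (f : Fin n → ℝ → ℂ) :
    ∫ x : EuclideanSpace ℝ (Fin n), ∏ j, f j (x j) = ∏ j, ∫ t, f j t := by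
  rw [← integral_fintype_prod_volume_eq_prod,
    ← (PiLp.volume_preserving_ofLp (Fin n)).integral_comp
      (MeasurableEquiv.toLp 2 (Fin n → ℝ)).symm.measurableEmbedding]

theorem continuous_hermiteFun (α : Fin n → ℕ) : Continuous (hermiteFun α) := by
  unfold hermiteFun
  exact Complex.continuous_ofReal.comp (continuous_finsetProd _ fun j _ =>
    (continuous_hermite1 (α j)).comp (by fun_prop))

theorem conj_hermiteFun (α : Fin n → ℕ) (x : EuclideanSpace ℝ (Fin n)) :
    (starRingEnd ℂ) (hermiteFun α x) = hermiteFun α x := Complex.conj_ofReal _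

theorem hermiteFun_zero (x : EuclideanSpace ℝ (Fin n)) :
    hermiteFun (0 : Fin n → ℕ) x = (Real.exp (-(‖x‖ ^ 2) / 2) : ℝ) := by
  simp only [hermiteFun, Pi.zero_apply, hermite1_zero, ← Real.exp_sum]
  congr 2
  rw [EuclideanSpace.norm_sq_eq, ← Finset.sum_div, Finset.sum_neg_distrib]
  simp

theorem coeFn_hermiteL2 (α : Fin n → ℕ) : hermiteL2 α =ᵐ[volume] hermiteFun α :=
  MemLp.coeFn_toLp _

theorem inner_hermiteL2 (α : Fin n → ℕ) (f : L2 n) :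
    ⟪hermiteL2 α, f⟫_ℂ = ∫ x, hermiteFun α x * f x := by
  rw [L2.inner_def]
  refine integral_congr_ae ?_
  filter_upwards [coeFn_hermiteL2 α] with x hx
  rw [hx, RCLike.inner_apply, conj_hermiteFun, mul_comm]

theorem inner_hermiteL2_hermiteL2 {α β : Fin n → ℕ} (h : α ≠ β) :
    ⟪hermiteL2 α, hermiteL2 β⟫_ℂ = 0 := by
  obtain ⟨j, hj⟩ := Function.ne_iff.1 h
  rw [inner_hermiteL2]
  have h1 : ∫ x, hermiteFun α x * hermiteL2 β x =
      ∫ x : EuclideanSpace ℝ (Fin n),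
        ∏ j, ((hermite1 (α j) (x j) * hermite1 (β j) (x j) : ℝ) : ℂ) := by
    refine integral_congr_ae ?_
    filter_upwards [coeFn_hermiteL2 β] with x hx
    rw [hx, hermiteFun, hermiteFun, ← Complex.ofReal_mul, ← Finset.prod_mul_distrib,
      Complex.ofReal_prod]
  rw [h1, integral_euclidean_prod
    (fun j t => ((hermite1 (α j) t * hermite1 (β j) t : ℝ) : ℂ))]
  refine Finset.prod_eq_zero (Finset.mem_univ j) ?_
  rw [integral_complex_ofReal, integral_hermite1_mul_hermite1 hj, Complex.ofReal_zero]

theorem coeFn_weyl (v : Fin n ⊕ Fin n → ℝ) (f : L2 n) : weyl v f =ᵐ[volume] weylFun v f :=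
  MemLp.coeFn_toLp _

/-- Translations preserve null sets. Hence the Weyl operators on classes can be computed with any
representative, in particular with the explicit Gaussian. -/
theorem weylFun_ae_congr (v : Fin n ⊕ Fin n → ℝ) {f g : EuclideanSpace ℝ (Fin n) → ℂ}
    (h : f =ᵐ[volume] g) : weylFun v f =ᵐ[volume] weylFun v g := by
  have := (measurePreserving_add_right (volume : Measure (EuclideanSpace ℝ (Fin n)))
    (WithLp.toLp 2 fun j => v (Sum.inr j))).quasiMeasurePreserving.ae_eq_comp h
  filter_upwards [this] with x hx
  simp only [Function.comp_apply] at hx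
  rw [weylFun, weylFun, hx]

theorem weyl_smul (v : Fin n ⊕ Fin n → ℝ) (c : ℂ) (f : L2 n) :
    weyl v (c • f) = c • weyl v f := by
  refine Lp.ext ?_
  filter_upwards [coeFn_weyl v (c • f), coeFn_weyl v f, Lp.coeFn_smul c (weyl v f),
    weylFun_ae_congr v (Lp.coeFn_smul c f)] with x h1 h2 h3 h4
  rw [h1, h3, h4, Pi.smul_apply, h2]
  simp only [weylFun, Pi.smul_apply, smul_eq_mul]
  ring

/-- The matrix coefficients of the displaced Gaussian. -/
theorem inner_hermiteL2_weyl (α : Fin n → ℕ) (v : Fin n ⊕ Fin n → ℝ) :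
    ⟪hermiteL2 α, weyl v (hermiteL2 0)⟫_ℂ = ((Real.pi : ℂ) ^ (1 / 2 : ℂ)) ^ n *
      (∏ j, ((v (Sum.inr j) : ℂ) - Complex.I * v (Sum.inl j)) ^ α j) *
        Real.exp (-(v ⬝ᵥ v) / 4) := by
  rw [inner_hermiteL2]
  have h1 : ∫ x, hermiteFun α x * weyl v (hermiteL2 0) x =
      ∫ x : EuclideanSpace ℝ (Fin n), ∏ j, (hermite1 (α j) (x j) : ℂ) *
        (Complex.exp (Complex.I * (v (Sum.inl j) * (x j + v (Sum.inr j) / 2) : ℝ)) *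
          hermite1 0 (x j + v (Sum.inr j))) := by
    refine integral_congr_ae ?_
    filter_upwards [coeFn_weyl v (hermiteL2 0),
      weylFun_ae_congr v (coeFn_hermiteL2 (0 : Fin n → ℕ))] with x h1 h2
    rw [h1, h2, weylFun, hermiteFun, hermiteFun, Finset.prod_mul_distrib, Finset.prod_mul_distrib,
      ← Complex.exp_sum, ← Finset.mul_sum]
    simp
  rw [h1, integral_euclidean_prod (fun j t => (hermite1 (α j) t : ℂ) *
        (Complex.exp (Complex.I * (v (Sum.inl j) * (t + v (Sum.inr j) / 2) : ℝ)) *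
          hermite1 0 (t + v (Sum.inr j))))]
  simp only [integral_hermite1_mul_displaced, Finset.prod_mul_distrib, Finset.prod_const,
    Finset.card_univ, Fintype.card_fin]
  congr 1
  rw [← Complex.ofReal_prod, ← Real.exp_sum]
  congr 2
  rw [← Finset.sum_div, Finset.sum_neg_distrib, dotProduct, Fintype.sum_sum_type,
    ← Finset.sum_add_distrib]
  simp only [sq]

instance finiteDimensional_W (l : ℕ) : FiniteDimensional ℂ (W n l) := by
  refine FiniteDimensional.span_of_finite ℂ ?_
  have : {f : L2 n | ∃ α : Fin n → ℕ, ∑ j, α j = l ∧ f = hermiteL2 α} ⊆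
      (hermiteL2 (n := n)) '' (Set.univ.pi fun _ => Set.Iic l) := by
    rintro f ⟨α, h, rfl⟩
    exact ⟨α, fun j _ =>
      h ▸ Finset.single_le_sum (fun _ _ => Nat.zero_le _) (Finset.mem_univ j), rfl⟩
  exact ((Set.Finite.pi fun _ => Set.finite_Iic l).image _).subset this

theorem hermiteL2_mem_W (α : Fin n → ℕ) : hermiteL2 α ∈ W n (∑ j, α j) :=
  Submodule.subset_span ⟨α, rfl, rfl⟩

theorem orthogonalFamily_W :
    OrthogonalFamily ℂ (fun l => W n l) fun l => (W n l).subtypeₗᵢ := by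
  refine OrthogonalFamily.of_pairwise fun k l hkl => ?_
  change Submodule.span ℂ _ ⟂ Submodule.span ℂ _
  rw [Submodule.isOrtho_span]
  rintro _ ⟨α, rfl, rfl⟩ _ ⟨β, rfl, rfl⟩
  exact inner_hermiteL2_hermiteL2 fun h => hkl (by rw [h])

/-- The number of the level is the degree of homogeneity of the matrix coefficients. -/
theorem inner_weyl_smul {l : ℕ} {w : L2 n} (hw : w ∈ W n l) (t : ℝ) (v : Fin n ⊕ Fin n → ℝ) :
    ⟪w, weyl (t • v) (hermiteL2 0)⟫_ℂ * Real.exp (t ^ 2 * (v ⬝ᵥ v) / 4) =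
      t ^ l * (⟪w, weyl v (hermiteL2 0)⟫_ℂ * Real.exp ((v ⬝ᵥ v) / 4)) := by
  induction hw using Submodule.span_induction with
  | mem w hw =>
    obtain ⟨α, rfl, rfl⟩ := hw
    have h0 : ∀ s : ℝ, Real.exp (-s / 4) * Real.exp (s / 4) = 1 := fun s => by
      rw [← Real.exp_add, ← Real.exp_zero]; ring_nf
    -- The exponential factors cancel the Gaussians on both sides; what remains is a monomial in the
    -- `bⱼ - i aⱼ`, homogeneous of degree `∑ αⱼ`.
    rw [inner_hermiteL2_weyl, inner_hermiteL2_weyl, mul_assoc, ← Complex.ofReal_mul, mul_assoc _ _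
      (Real.exp ((v ⬝ᵥ v) / 4) : ℂ), ← Complex.ofReal_mul, h0]
    have h1 : t • v ⬝ᵥ t • v = t ^ 2 * (v ⬝ᵥ v) := by
      simp [dotProduct_smul, smul_dotProduct]; ring
    rw [h1, h0, ← Finset.prod_pow_eq_pow_sum]
    have h2 : ∀ j, (((t • v) (Sum.inr j) : ℂ) - Complex.I * ((t • v) (Sum.inl j) : ℝ)) ^ α j =
        (t : ℂ) ^ α j * ((v (Sum.inr j) : ℂ) - Complex.I * v (Sum.inl j)) ^ α j := by
      intro j
      rw [← mul_pow]
      simp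
      ring
    simp only [h2, Finset.prod_mul_distrib]
    ring
  | zero => simp
  | add w w' _ _ h h' => rw [inner_add_left, inner_add_left]; linear_combination h + h'
  | smul c w _ h =>
    rw [inner_smul_left, inner_smul_left]
    linear_combination (starRingEnd ℂ c) * h

/-- The displaced Gaussians form a total set. -/
theorem eq_zero_of_inner_weyl_eq_zero {f : L2 n}
    (h : ∀ v, ⟪f, weyl v (hermiteL2 0)⟫_ℂ = 0) : f = 0 := by
  have h1 : Integrable fun x => (starRingEnd ℂ) (f x) * hermiteFun (0 : Fin n → ℕ) x := by
    refine (L2.integrable_inner (𝕜 := ℂ) f (hermiteL2 0)).congr ?_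
    filter_upwards [coeFn_hermiteL2 (0 : Fin n → ℕ)] with x hx
    rw [hx, RCLike.inner_apply, mul_comm]
  -- Displacements with `b = 0` suffice: they give all the Fourier coefficients of the conjugate of
  -- `f` times the Gaussian, and the Gaussian has no zeros.
  have h2 := ae_eq_zero_of_integral_exp_inner_eq_zero h1 fun a => by
    rw [← h (Sum.elim a 0), L2.inner_def]
    refine integral_congr_ae ?_
    filter_upwards [coeFn_weyl (Sum.elim a 0) (hermiteL2 0),
      weylFun_ae_congr (Sum.elim a 0) (coeFn_hermiteL2 (0 : Fin n → ℕ))] with x h1 h2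
    have h3 : WithLp.toLp 2 (fun j => (Sum.elim a 0 : Fin n ⊕ Fin n → ℝ) (Sum.inr j)) =
      (0 : EuclideanSpace ℝ (Fin n)) := by ext; simp
    rw [h1, h2, weylFun, h3, RCLike.inner_apply, PiLp.inner_apply]
    simp [mul_comm]
    ring
  refine Lp.ext ?_
  filter_upwards [h2, Lp.coeFn_zero ℂ 2 (volume : Measure (EuclideanSpace ℝ (Fin n)))] with x hx h0
  rw [h0]
  rw [hermiteFun_zero] at hx
  simpa [Real.exp_ne_zero] using hx

end Hermite

/-! ### Completeness of the Hermite functions -/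

section Complete

variable {n : ℕ}

/-- This is `mul_hermite1` in the `j`-th factor only; when `α j = 0` the truncated index is
multiplied by zero. -/
theorem coord_mul_hermiteFun (α : Fin n → ℕ) (j : Fin n) (x : EuclideanSpace ℝ (Fin n)) :
    (x j : ℂ) * hermiteFun α x = -(α j) * hermiteFun (Function.update α j (α j - 1)) x -
      2⁻¹ * hermiteFun (Function.update α j (α j + 1)) x := by
  have h : ∀ m, hermiteFun (Function.update α j m) x =
      (hermite1 m (x j) : ℂ) * ∏ i ∈ Finset.univ.erase j, (hermite1 (α i) (x i) : ℂ) := by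
    intro m
    rw [hermiteFun, Complex.ofReal_prod, ← Finset.mul_prod_erase _ _ (Finset.mem_univ j),
      Function.update_self]
    congr 1
    refine Finset.prod_congr rfl fun i hi => ?_
    rw [Function.update_of_ne (Finset.ne_of_mem_erase hi)]
  have h0 := h (α j)
  rw [Function.update_eq_self] at h0
  rw [h0, h, h]
  have := congrArg Complex.ofReal (mul_hermite1 (α j) (x j))
  push_cast at this
  linear_combination (∏ i ∈ Finset.univ.erase j, (hermite1 (α i) (x i) : ℂ)) * this

/-- The span of the Hermite functions is stable under multiplication by linear forms. -/
theorem inner_mul_mem_span_hermiteFun (a : EuclideanSpace ℝ (Fin n))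
    {f : EuclideanSpace ℝ (Fin n) → ℂ}
    (hf : f ∈ Submodule.span ℂ (Set.range (hermiteFun (n := n)))) :
    (fun x => (⟪a, x⟫_ℝ : ℂ) * f x) ∈ Submodule.span ℂ (Set.range (hermiteFun (n := n))) := by
  induction hf using Submodule.span_induction with
  | mem f hf =>
    obtain ⟨α, rfl⟩ := hf
    have : (fun x => ((⟪a, x⟫_ℝ : ℝ) : ℂ) * hermiteFun α x) = ∑ j, (a j : ℂ) •
        (-(α j : ℂ) • hermiteFun (Function.update α j (α j - 1)) -
          (2⁻¹ : ℂ) • hermiteFun (Function.update α j (α j + 1))) := by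
      funext x
      simp only [Finset.sum_apply, Pi.smul_apply, Pi.sub_apply, smul_eq_mul,
        ← coord_mul_hermiteFun]
      rw [PiLp.inner_apply]
      push_cast
      rw [Finset.sum_mul]
      refine Finset.sum_congr rfl fun j _ => ?_
      simp
      ring
    rw [this]
    exact Submodule.sum_mem _ fun j _ => Submodule.smul_mem _ _ (Submodule.sub_mem _
      (Submodule.smul_mem _ _ (Submodule.subset_span ⟨_, rfl⟩))
      (Submodule.smul_mem _ _ (Submodule.subset_span ⟨_, rfl⟩)))
  | zero =>
    simp only [Pi.zero_apply, mul_zero]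
    exact Submodule.zero_mem _
  | add f g _ _ hf hg =>
    convert Submodule.add_mem _ hf hg using 1
    funext x
    simp [mul_add]
  | smul c f _ hf =>
    convert Submodule.smul_mem _ c hf using 1
    funext x
    simp
    ring

/-- Half of the exponent of `h₀`: what is left for domination once the other half has absorbed `exp
|⟪a, x⟫|`. -/
theorem memLp_exp_neg_norm_sq :
    MemLp (fun x : EuclideanSpace ℝ (Fin n) => Real.exp (-(‖x‖ ^ 2) / 4)) 2 volume := by
  rw [memLp_two_iff_integrable_sq (by fun_prop)]
  have := (GaussianFourier.integrable_cexp_neg_mul_sq_norm_add (b := 2⁻¹) (by norm_num) 0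
    (0 : EuclideanSpace ℝ (Fin n))).norm
  refine this.congr (Filter.Eventually.of_forall fun x => ?_)
  simp only [Complex.norm_exp, ← Real.exp_nat_mul]
  congr 1
  have h : ((‖x‖ : ℂ) ^ 2).re = ‖x‖ ^ 2 := by rw [← Complex.ofReal_pow, Complex.ofReal_re]
  simp [h]
  ring

/-- The Hermite functions are complete in `L²(ℝⁿ)`. -/
theorem eq_zero_of_inner_hermiteL2_eq_zero {f : L2 n} (h : ∀ α, ⟪hermiteL2 α, f⟫_ℂ = 0) :
    f = 0 := by
  have hint : ∀ {g : EuclideanSpace ℝ (Fin n) → ℂ}, MemLp g 2 volume →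
      Integrable fun x => g x * f x := fun hg => hg.integrable_mul (Lp.memLp f)
  have h1 : ∀ g ∈ Submodule.span ℂ (Set.range (hermiteFun (n := n))),
      MemLp g 2 volume ∧ ∫ x, g x * f x = 0 := by
    intro g hg
    induction hg using Submodule.span_induction with
    | mem g hg =>
      obtain ⟨α, rfl⟩ := hg
      exact ⟨memLp_hermiteFun α, by rw [← inner_hermiteL2, h]⟩
    | zero => exact ⟨MemLp.zero, by simp⟩
    | add g g' _ _ hg hg' =>
      refine ⟨hg.1.add hg'.1, ?_⟩
      simp only [Pi.add_apply, add_mul]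
      rw [integral_add (hint hg.1) (hint hg'.1), hg.2, hg'.2, add_zero]
    | smul c g _ hg =>
      refine ⟨hg.1.const_smul c, ?_⟩
      simp only [Pi.smul_apply, smul_eq_mul, mul_assoc]
      rw [integral_const_mul, hg.2, mul_zero]
  have h2 : ∀ (a : EuclideanSpace ℝ (Fin n)) (k : ℕ),
      (fun x => (⟪a, x⟫_ℝ : ℂ) ^ k * hermiteFun 0 x) ∈
        Submodule.span ℂ (Set.range (hermiteFun (n := n))) := by
    intro a k
    induction k with
    | zero =>
      have : hermiteFun 0 ∈ Submodule.span ℂ (Set.range (hermiteFun (n := n))) :=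
        Submodule.subset_span ⟨0, rfl⟩
      simpa using this
    | succ k ih =>
      convert inner_mul_mem_span_hermiteFun a ih using 1
      funext x
      ring
  have h3 : ∀ a : EuclideanSpace ℝ (Fin n),
      ∫ x, Complex.exp (Complex.I * (⟪a, x⟫_ℝ : ℝ)) * (hermiteFun 0 x * f x) = 0 := by
    intro a
    -- The exponential is expanded in its power series. Each term times the Gaussian lies in the
    -- span of the Hermite functions, so its integral against `f` is zero.
    have hs := hasSum_integral_of_dominated_convergence
      (μ := (volume : Measure (EuclideanSpace ℝ (Fin n))))
      (F := fun (k : ℕ) x => ((Complex.I * (⟪a, x⟫_ℝ : ℝ)) ^ k / k.factorial) *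
        (hermiteFun 0 x * f x))
      (f := fun x => Complex.exp (Complex.I * (⟪a, x⟫_ℝ : ℝ)) * (hermiteFun 0 x * f x))
      (fun k x => (|⟪a, x⟫_ℝ| ^ k / k.factorial) * ‖hermiteFun 0 x * f x‖)
      ?_ ?_ ?_ ?_ ?_
    · have h4 : ∀ k : ℕ, ∫ x, ((Complex.I * (⟪a, x⟫_ℝ : ℝ)) ^ k / k.factorial) *
          (hermiteFun 0 x * f x) = 0 := by
        intro k
        have := (h1 _ (h2 a k)).2
        rw [← mul_zero (Complex.I ^ k / k.factorial : ℂ), ← this, ← integral_const_mul]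
        congr 1
        funext x
        ring
      simp only [h4] at hs
      exact hs.unique hasSum_zero
    · intro k
      refine AEStronglyMeasurable.mul (Continuous.aestronglyMeasurable (by fun_prop)) ?_
      exact (hint (memLp_hermiteFun 0)).1
    · intro k
      refine Filter.Eventually.of_forall fun x => ?_
      simp
    · refine Filter.Eventually.of_forall fun x => ?_
      exact (Real.summable_pow_div_factorial _).mul_right _
    · have h5 : (fun x => ∑' k : ℕ, (|⟪a, x⟫_ℝ| ^ k / k.factorial) * ‖hermiteFun 0 x * f x‖) =
          fun x => Real.exp |⟪a, x⟫_ℝ| * ‖hermiteFun 0 x * f x‖ := by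
        funext x
        rw [tsum_mul_right, Real.exp_eq_exp_ℝ, NormedSpace.exp_eq_tsum_div]
      rw [h5]
      -- Here `‖a‖ ‖x‖ ≤ ‖a‖² + ‖x‖² / 4` is used; the remaining factor is a product of two
      -- square-integrable functions.
      have h6 : Integrable fun x => (Real.exp (‖a‖ ^ 2) * Real.exp (-(‖x‖ ^ 2) / 4)) * ‖f x‖ :=
        (memLp_exp_neg_norm_sq.const_mul _).integrable_mul (Lp.memLp f).norm
      refine h6.mono' ?_ (Filter.Eventually.of_forall fun x => ?_)
      · exact AEStronglyMeasurable.mul (Continuous.aestronglyMeasurable (by fun_prop))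
          (hint (memLp_hermiteFun 0)).1.norm
      · rw [norm_mul, norm_norm, norm_mul, ← mul_assoc, hermiteFun_zero, Complex.norm_real,
          Real.norm_eq_abs, Real.norm_eq_abs, Real.abs_exp, Real.abs_exp, ← Real.exp_add,
          ← Real.exp_add]
        refine mul_le_mul_of_nonneg_right (Real.exp_le_exp.2 ?_) (norm_nonneg _)
        have := abs_real_inner_le_norm a x
        nlinarith [sq_nonneg (‖a‖ - ‖x‖ / 2)]
    · refine Filter.Eventually.of_forall fun x => HasSum.mul_right _ ?_
      rw [Complex.exp_eq_exp_ℂ]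
      exact NormedSpace.expSeries_div_hasSum_exp _
  have h4 := ae_eq_zero_of_integral_exp_inner_eq_zero (hint (memLp_hermiteFun 0)) h3
  refine Lp.ext ?_
  filter_upwards [h4, Lp.coeFn_zero ℂ 2 (volume : Measure (EuclideanSpace ℝ (Fin n)))] with x hx h0
  rw [h0]
  rw [hermiteFun_zero] at hx
  simpa [Real.exp_ne_zero] using hx

/-- `L²(ℝⁿ)` is the Hilbert sum of the spaces `𝔚_l`. -/
theorem isHilbertSum_W :
    IsHilbertSum ℂ (fun l => W n l) fun l => (W n l).subtypeₗᵢ := by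
  refine IsHilbertSum.mkInternal _ orthogonalFamily_W ?_
  rw [top_le_iff, Submodule.topologicalClosure_eq_top_iff, Submodule.eq_bot_iff]
  intro f hf
  refine eq_zero_of_inner_hermiteL2_eq_zero fun α => ?_
  exact hf _ (Submodule.mem_iSup_of_mem _ (hermiteL2_mem_W α))

end Complete

/-! ### Invariance of the levels under the unitary group -/

section Unitary

variable {n : ℕ}

/-- The power series represents the zero function at the origin, and such a representation is
unique. It serves to separate the levels by their degrees of homogeneity. -/
theorem eq_zero_of_hasSum_pow_mul {a : ℕ → ℂ} (h : ∀ t : ℝ, HasSum (fun k => (t : ℂ) ^ k * a k) 0)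
    (k : ℕ) : a k = 0 := by
  let p : FormalMultilinearSeries ℝ ℝ ℂ :=
    fun k => ContinuousMultilinearMap.mkPiRing ℝ (Fin k) (a k)
  have hp : ∀ k, p.coeff k = a k := fun k => by simp [p, FormalMultilinearSeries.coeff]
  have h1 : HasFPowerSeriesAt (0 : ℝ → ℂ) p 0 := by
    refine hasFPowerSeriesAt_iff.2 (Filter.Eventually.of_forall fun t => ?_)
    simpa [hp] using h t
  rw [← hp, h1.eq_zero]
  rfl

/-- The Gaussian is determined up to a scalar by the expectation values of the Weyl operators. -/
theorem exists_eq_smul_of_inner_weyl_eq {f : L2 n}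
    (h : ∀ v, ⟪f, weyl v f⟫_ℂ = ⟪hermiteL2 0, weyl v (hermiteL2 0)⟫_ℂ) :
    ∃ c : ℂ, f = c • hermiteL2 0 := by
  set g : EuclideanSpace ℝ (Fin n) → ℂ := hermiteFun 0
  have hg : ∀ x, g x ≠ 0 := fun x => by simp [g, hermiteFun_zero]
  -- For fixed `b`, the expectations as functions of `a` are Fourier transforms of the
  -- autocorrelation integrands, up to a common phase; injectivity identifies the integrands.
  have key : ∀ b : EuclideanSpace ℝ (Fin n), ∀ᵐ x,
      (starRingEnd ℂ) (f x) * f (x + b) = g x * g (x + b) := by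
    intro b
    have hint : ∀ φ : L2 n, Integrable fun x => (starRingEnd ℂ) (φ x) * φ (x + b) := fun φ =>
      (Lp.memLp φ).star.integrable_mul
        ((Lp.memLp φ).comp_measurePreserving (measurePreserving_add_right volume b))
    have hval : ∀ (φ : L2 n) (a : EuclideanSpace ℝ (Fin n)), ⟪φ, weyl (Sum.elim a b) φ⟫_ℂ =
        Complex.exp (Complex.I * (⟪a, b⟫_ℝ / 2 : ℝ)) *
          ∫ x, Complex.exp (Complex.I * (⟪a, x⟫_ℝ : ℝ)) * ((starRingEnd ℂ) (φ x) * φ (x + b)) := by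
      intro φ a
      rw [L2.inner_def, ← integral_const_mul]
      refine integral_congr_ae ?_
      filter_upwards [coeFn_weyl (Sum.elim a b) φ] with x hx
      have h1 : ∑ j, a j * (x j + b j / 2) = ⟪a, b⟫_ℝ / 2 + ⟪a, x⟫_ℝ := by
        rw [PiLp.inner_apply, PiLp.inner_apply, Finset.sum_div, ← Finset.sum_add_distrib]
        refine Finset.sum_congr rfl fun j _ => ?_
        simp
        ring
      rw [hx, RCLike.inner_apply, weylFun]
      simp only [Sum.elim_inl, Sum.elim_inr, h1]
      rw [Complex.ofReal_add, mul_add, Complex.exp_add]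
      change _ * _ * φ (x + b) * _ = _
      ring
    have h2 := ae_eq_zero_of_integral_exp_inner_eq_zero ((hint f).sub (hint (hermiteL2 0)))
      fun a => by
        have h3 := h (Sum.elim a b)
        rw [hval, hval] at h3
        have h4 := mul_left_cancel₀ (Complex.exp_ne_zero _) h3
        have hexp : ∀ φ : L2 n, Integrable fun x => Complex.exp (Complex.I * (⟪a, x⟫_ℝ : ℝ)) *
            ((starRingEnd ℂ) (φ x) * φ (x + b)) := fun φ => by
          refine (hint φ).norm.mono' ((Continuous.aestronglyMeasurable (by fun_prop)).mul
            (hint φ).1) (Filter.Eventually.of_forall fun x => ?_)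
          rw [norm_mul, mul_comm Complex.I, Complex.norm_exp_ofReal_mul_I, one_mul]
        simp only [Pi.sub_apply, mul_sub]
        rw [integral_sub (hexp f) (hexp _), h4, sub_self]
    have h5 := (measurePreserving_add_right (volume : Measure (EuclideanSpace ℝ (Fin n)))
      b).quasiMeasurePreserving.ae_eq_comp (coeFn_hermiteL2 (0 : Fin n → ℕ))
    filter_upwards [h2, h5, coeFn_hermiteL2 (0 : Fin n → ℕ)] with x h6 h7 h8
    simp only [Function.comp_apply] at h7
    simp only [Pi.sub_apply, Pi.zero_apply, sub_eq_zero, h7, h8, conj_hermiteFun] at h6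
    exact h6
  have hf : Measurable f := (Lp.stronglyMeasurable f).measurable
  have hgm : Measurable g := (continuous_hermiteFun 0).measurable
  have hcont : Measurable fun z : ℂ => (starRingEnd ℂ) z := Complex.continuous_conj.measurable
  have hmeas : MeasurableSet {p : EuclideanSpace ℝ (Fin n) × EuclideanSpace ℝ (Fin n) |
      (starRingEnd ℂ) (f p.2) * f (p.2 + p.1) = g p.2 * g (p.2 + p.1)} :=
    measurableSet_eq_fun
      ((hcont.comp (hf.comp measurable_snd)).mul (hf.comp (measurable_snd.add measurable_fst)))
      ((hgm.comp measurable_snd).mul (hgm.comp (measurable_snd.add measurable_fst)))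
  -- Exchanging the quantifiers by Fubini yields one point `x` that works for almost every shift
  -- `b`; then `y = x + b` covers almost every point, and `f` is proportional to `g`.
  obtain ⟨x, hx⟩ := ((Measure.ae_ae_comm (μ := volume) (ν := volume) hmeas).1
    (Filter.Eventually.of_forall key)).exists
  have hy : ∀ᵐ y, (starRingEnd ℂ) (f x) * f y = g x * g y := by
    have := (measurePreserving_add_left (volume : Measure (EuclideanSpace ℝ (Fin n)))
      (-x)).quasiMeasurePreserving.ae hx
    simpa using this
  have hfx : (starRingEnd ℂ) (f x) ≠ 0 := by
    obtain ⟨y, hy⟩ := hy.exists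
    intro h0
    rw [h0, zero_mul] at hy
    exact mul_ne_zero (hg x) (hg y) hy.symm
  refine ⟨g x / (starRingEnd ℂ) (f x), Lp.ext ?_⟩
  filter_upwards [hy, Lp.coeFn_smul (g x / (starRingEnd ℂ) (f x)) (hermiteL2 (0 : Fin n → ℕ)),
    coeFn_hermiteL2 (0 : Fin n → ℕ)] with y h1 h2 h3
  rw [h2, Pi.smul_apply, h3, smul_eq_mul]
  field_simp
  rw [mul_comm, h1]

/-- The elements of `𝔚_l` are characterized by the homogeneity of their matrix coefficients. -/
theorem mem_W_of_inner_weyl_smul {l : ℕ} {f : L2 n}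
    (h : ∀ (t : ℝ) (v : Fin n ⊕ Fin n → ℝ),
      ⟪f, weyl (t • v) (hermiteL2 0)⟫_ℂ * Real.exp (t ^ 2 * (v ⬝ᵥ v) / 4) =
        t ^ l * (⟪f, weyl v (hermiteL2 0)⟫_ℂ * Real.exp ((v ⬝ᵥ v) / 4))) : f ∈ W n l := by
  set y := isHilbertSum_W.linearIsometryEquiv f
  have hsum : HasSum (fun k => (y k : L2 n)) f := by
    have := isHilbertSum_W.hasSum_linearIsometryEquiv_symm y
    rwa [LinearIsometryEquiv.symm_apply_apply] at this
  have hcoef : ∀ k (v : Fin n ⊕ Fin n → ℝ), k ≠ l →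
      ⟪(y k : L2 n), weyl v (hermiteL2 0)⟫_ℂ = 0 := by
    intro k v hk
    -- `a k` is the coefficient of `t ^ k` in a vanishing difference: expanding `f` into its
    -- components gives `∑ t ^ k` times their coefficients at `v`, while by hypothesis the total is
    -- the single term `t ^ l` times the coefficient of `f`.
    set a : ℕ → ℂ := fun k =>
      ⟪(y k : L2 n), weyl v (hermiteL2 0)⟫_ℂ * Real.exp ((v ⬝ᵥ v) / 4) -
        if k = l then ⟪f, weyl v (hermiteL2 0)⟫_ℂ * Real.exp ((v ⬝ᵥ v) / 4) else 0
    have h1 : ∀ t : ℝ, HasSum (fun k => (t : ℂ) ^ k * a k) 0 := by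
      intro t
      have h2 := ((((innerSL ℂ (weyl (t • v) (hermiteL2 0))).hasSum hsum).map
        (starRingEnd ℂ).toAddMonoidHom Complex.continuous_conj).mul_right
          (Real.exp (t ^ 2 * (v ⬝ᵥ v) / 4) : ℂ))
      have h3 : ∀ w : L2 n, (starRingEnd ℂ) (innerSL ℂ (weyl (t • v) (hermiteL2 0)) w) =
          ⟪w, weyl (t • v) (hermiteL2 0)⟫_ℂ := fun w => by
        rw [innerSL_apply_apply, inner_conj_symm]
      have h4 := hasSum_ite_eq l
        ((t : ℂ) ^ l * (⟪f, weyl v (hermiteL2 0)⟫_ℂ * Real.exp ((v ⬝ᵥ v) / 4)))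
      have h5 := h2.sub h4
      simp only [Function.comp_apply, RingHom.toAddMonoidHom_eq_coe, AddMonoidHom.coe_coe,
        h3, h, sub_self] at h5
      refine Eq.subst (motive := fun F : ℕ → ℂ => HasSum F 0) (funext fun k => ?_) h5
      simp only [a, inner_weyl_smul (y k).2 t v, mul_sub]
      by_cases hkl : k = l
      · simp [hkl]
      · simp [hkl]
    simpa [a, hk, Real.exp_ne_zero] using eq_zero_of_hasSum_pow_mul h1 k
  have hzero : ∀ k, k ≠ l → (y k : L2 n) = 0 := fun k hk =>
    eq_zero_of_inner_weyl_eq_zero fun v => hcoef k v hk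
  rw [hsum.unique (hasSum_single l hzero)]
  exact (y l).2

/-- The spaces `𝔚_l` are invariant under the unitary operators that implement orthogonal
transformations of the phase space. -/
theorem map_mem_W {A : Matrix (Fin n ⊕ Fin n) (Fin n ⊕ Fin n) ℝ} (hA : A * Aᵀ = 1)
    (U : L2 n ≃ₗᵢ[ℂ] L2 n) (hU : ∀ v f, U (weyl v f) = weyl (A *ᵥ v) (U f))
    {l : ℕ} {w : L2 n} (hw : w ∈ W n l) : U w ∈ W n l := by
  have hA' : Aᵀ * A = 1 := mul_eq_one_comm.1 hA
  have hdot : ∀ v, (Aᵀ *ᵥ v) ⬝ᵥ (Aᵀ *ᵥ v) = v ⬝ᵥ v := fun v => by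
    rw [dotProduct_mulVec, vecMul_transpose, mulVec_mulVec, hA, one_mulVec]
  have hU' : ∀ v f, weyl v (U f) = U (weyl (Aᵀ *ᵥ v) f) := fun v f => by
    rw [hU, mulVec_mulVec, hA, one_mulVec]
  -- Moving `U` across replaces `v` by `Aᵀ v`, and the expectation of `r(v)` in the Gaussian sees
  -- only `v·v`, which `Aᵀ` preserves.
  obtain ⟨c, hc⟩ := exists_eq_smul_of_inner_weyl_eq (f := U (hermiteL2 0)) fun v => by
    rw [hU', LinearIsometryEquiv.inner_map_map, inner_hermiteL2_weyl, inner_hermiteL2_weyl, hdot]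
    simp
  have hc0 : c ≠ 0 := by
    rintro rfl
    rw [zero_smul, LinearIsometryEquiv.map_eq_zero_iff] at hc
    have := inner_hermiteL2_weyl (n := n) 0 0
    rw [hc] at this
    have hpi : (Real.pi : ℂ) ^ (1 / 2 : ℂ) ≠ 0 := by
      rw [Complex.cpow_ne_zero_iff_of_exponent_ne_zero (by norm_num)]
      exact_mod_cast Real.pi_ne_zero
    exact pow_ne_zero n hpi (by simpa using this.symm)
  have hcoef : ∀ v, c * ⟪U w, weyl v (hermiteL2 0)⟫_ℂ = ⟪w, weyl (Aᵀ *ᵥ v) (hermiteL2 0)⟫_ℂ := by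
    intro v
    rw [← inner_smul_right, ← weyl_smul, ← hc, hU', LinearIsometryEquiv.inner_map_map]
  refine mem_W_of_inner_weyl_smul fun t v => ?_
  have := inner_weyl_smul hw t (Aᵀ *ᵥ v)
  rw [← mulVec_smul, ← hcoef, ← hcoef, hdot] at this
  refine mul_left_cancel₀ hc0 ?_
  linear_combination this

/-- The matrices in the unitary group are orthogonal. -/
theorem mul_transpose_of_mem_UHat {q : Mp n} (hq : q ∈ UHat n) :
    ((Mp.rho q : symplecticGroup (Fin n) ℝ) : Matrix (Fin n ⊕ Fin n) (Fin n ⊕ Fin n) ℝ) *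
      ((Mp.rho q : symplecticGroup (Fin n) ℝ) :
        Matrix (Fin n ⊕ Fin n) (Fin n ⊕ Fin n) ℝ)ᵀ = 1 := by
  have h1 : _ * _ = _ * _ := hq
  have h2 := SymplecticGroup.mem_iff.1 (Mp.rho q).2
  generalize ((Mp.rho q : symplecticGroup (Fin n) ℝ) :
    Matrix (Fin n ⊕ Fin n) (Fin n ⊕ Fin n) ℝ) = A at *
  -- `A J Aᵀ = J` together with `A J = J A` gives `J A Aᵀ = J`, and `-J` inverts `J`.
  rw [h1, Matrix.mul_assoc] at h2
  have h3 := congrArg (fun B => -(J (Fin n) ℝ * B)) h2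
  simpa [← Matrix.mul_assoc, J_squared] using h3

/-- The commutator subgroup lies in `MpC n`, so each operator implements its matrix; over `UHat n`
that matrix is orthogonal and `map_mem_W` applies. -/
theorem unitaryRep_mem_W (l : ℕ) (q : UHat n) (w : L2 n) (hw : w ∈ W n l) :
    unitaryRep n q w ∈ W n l :=
  map_mem_W (mul_transpose_of_mem_UHat q.2) _
    (Subgroup.commutator_le_self _ (q : Mp n).2 : _ ∈ MpC n) hw

end Unitary

/-! ### Trivializations and closed embeddings of associated bundles -/

namespace Assoc

variable {G : Type*} [Group G] {H : Subgroup G}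
  {V : Type*} [NormedAddCommGroup V] [InnerProductSpace ℂ V]
  {V' : Type*} [NormedAddCommGroup V'] [InnerProductSpace ℂ V']

/-- The identification of `G ×_lam V` with `(G ⧸ H) × V` given by a choice of representatives. -/
def prodEquiv (lam : H →* (V ≃ₗᵢ[ℂ] V)) (s : G ⧸ H → G) (hs : ∀ x, (s x : G ⧸ H) = x) :
    Assoc lam ≃ (G ⧸ H) × V where
  toFun := Quotient.lift (fun p : G × V => ((p.1 : G ⧸ H),
    lam ⟨(s p.1)⁻¹ * p.1, QuotientGroup.eq.1 (hs _)⟩ p.2)) (by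
      rintro ⟨g, f⟩ ⟨g', f'⟩ ⟨h, h1, h2⟩
      dsimp only at h1 h2
      subst h1 h2
      have e : ((g * h : G) : G ⧸ H) = g := QuotientGroup.mk_mul_of_mem g h.2
      refine Prod.ext e.symm ?_
      dsimp only
      change (lam _ * lam h) f' = _
      rw [← map_mul]
      congr 2
      exact Subtype.ext (by simp [e, mul_assoc]))
  invFun p := mk lam (s p.1) p.2
  left_inv q := by
    obtain ⟨⟨g, f⟩, rfl⟩ := Quotient.exists_rep (s := assocSetoid lam) q
    change mk lam (s g) (lam _ f) = mk lam g f
    rw [← mk_mul]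
    simp
  right_inv p := by
    obtain ⟨x, f⟩ := p
    refine Prod.ext (hs x) ?_
    change lam _ f = f
    have : (⟨(s (s x : G ⧸ H))⁻¹ * s x, QuotientGroup.eq.1 (hs _)⟩ : H) = 1 :=
      Subtype.ext (by simp [hs])
    rw [this, map_one]
    rfl

theorem prodEquiv_fst (lam : H →* (V ≃ₗᵢ[ℂ] V)) (s : G ⧸ H → G) (hs : ∀ x, (s x : G ⧸ H) = x)
    (q : Assoc lam) : (prodEquiv lam s hs q).1 = proj lam q := by
  obtain ⟨⟨g, f⟩, rfl⟩ := Quotient.exists_rep (s := assocSetoid lam) q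
  rfl

theorem prodEquiv_map {lam' : H →* (V' ≃ₗᵢ[ℂ] V')} {lam : H →* (V ≃ₗᵢ[ℂ] V)} (j : V' →ₗᵢ[ℂ] V)
    (hj : ∀ h f, j (lam' h f) = lam h (j f)) (s : G ⧸ H → G) (hs : ∀ x, (s x : G ⧸ H) = x)
    (q : Assoc lam') :
    prodEquiv lam s hs (map j hj q) = (proj lam' q, j (prodEquiv lam' s hs q).2) := by
  obtain ⟨⟨g, f⟩, rfl⟩ := Quotient.exists_rep (s := assocSetoid lam') q
  refine Prod.ext rfl ?_
  exact (hj _ _).symm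

section Topology

variable [TopologicalSpace G]

theorem isQuotientMap_mk (lam : H →* (V ≃ₗᵢ[ℂ] V)) :
    IsQuotientMap fun p : G × V => mk lam p.1 p.2 := isQuotientMap_quotient_mk'

theorem continuous_proj (lam : H →* (V ≃ₗᵢ[ℂ] V)) : Continuous (proj lam) :=
  (isQuotientMap_mk lam).continuous_iff.2 (continuous_quotient_mk'.comp continuous_fst)

/-- The operators are isometries, hence 1-Lipschitz uniformly in `h`, and separate continuity
becomes joint continuity. -/
theorem continuous_apply_of_stronglyContinuous {lam : H →* (V ≃ₗᵢ[ℂ] V)}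
    (hlam : ∀ f, Continuous fun h => lam h f) : Continuous fun p : H × V => lam p.1 p.2 :=
  continuous_prod_of_continuous_lipschitzWith' (fun p : H × V => lam p.1 p.2) 1
    (fun h => (lam h).lipschitz) hlam

/-- The bundle map induced by an equivariant isometry with an equivariant left inverse is a closed
embedding. -/
theorem isClosedEmbedding_map {lam' : H →* (V' ≃ₗᵢ[ℂ] V')} {lam : H →* (V ≃ₗᵢ[ℂ] V)}
    (j : V' →ₗᵢ[ℂ] V) (hj : ∀ h f, j (lam' h f) = lam h (j f)) (r : V →L[ℂ] V')
    (hr : ∀ h f, r (lam h f) = lam' h (r f)) (hrj : ∀ f, r (j f) = f) :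
    IsClosedEmbedding (map (G := G) j hj) := by
  let R : Assoc lam → Assoc lam' :=
    Quotient.map (sa := assocSetoid lam) (sb := assocSetoid lam') (fun p => (p.1, r p.2)) (by
      rintro p q ⟨h, h1, h2⟩
      exact ⟨h, h1, by simp [h2, hr]⟩)
  have hR : Continuous R := (isQuotientMap_mk lam).continuous_iff.2
    ((isQuotientMap_mk lam').continuous.comp
      (continuous_fst.prodMk (r.continuous.comp continuous_snd)))
  have hM : Continuous (map (G := G) j hj) := (isQuotientMap_mk lam').continuous_iff.2
    ((isQuotientMap_mk lam).continuous.comp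
      (continuous_fst.prodMk (j.continuous.comp continuous_snd)))
  have hinv : Function.LeftInverse R (map j hj) := by
    intro q
    obtain ⟨⟨g, f⟩, rfl⟩ := Quotient.exists_rep (s := assocSetoid lam') q
    change mk lam' g (r (j f)) = mk lam' g f
    rw [hrj]
  refine ⟨IsEmbedding.of_leftInverse hinv hR hM, ?_⟩
  rw [← (isQuotientMap_mk lam).isClosed_preimage]
  -- The range is the fixed-point set of `j ∘ r` in each fibre, a condition independent of the
  -- representative by equivariance; upstairs it is visibly closed.
  have : (fun p : G × V => mk lam p.1 p.2) ⁻¹' Set.range (map j hj) =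
      {p : G × V | j (r p.2) = p.2} := by
    ext ⟨g, f⟩
    constructor
    · rintro ⟨q, hq⟩
      obtain ⟨⟨g', f'⟩, rfl⟩ := Quotient.exists_rep (s := assocSetoid lam') q
      obtain ⟨h, -, h2⟩ := Quotient.exact (s := assocSetoid lam) hq
      have h3 : f = lam h⁻¹ (j f') := by
        rw [show j f' = lam h f from h2, map_inv]
        exact ((lam h).symm_apply_apply f).symm
      change j (r f) = f
      rw [h3, ← hj, hrj]
    · intro hf
      exact ⟨mk lam' g (r f), congrArg (mk lam g) hf⟩
  rw [this]
  exact isClosed_eq (j.continuous.comp (r.continuous.comp continuous_snd)) continuous_snd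

variable [IsTopologicalGroup G]

/-- The local trivialization of `G ×_lam V` given by a local section of `G → G ⧸ H`. -/
def trivialization (lam : H →* (V ≃ₗᵢ[ℂ] V)) (hlam : ∀ f, Continuous fun h => lam h f)
    (s : G ⧸ H → G) (hs : ∀ x, (s x : G ⧸ H) = x) {U : Set (G ⧸ H)} (hU : IsOpen U)
    (hsU : ContinuousOn s U) : Bundle.Trivialization V (proj lam) where
  toFun := prodEquiv lam s hs
  invFun := (prodEquiv lam s hs).symm
  source := proj lam ⁻¹' U
  target := U ×ˢ Set.univ
  map_source' q hq := ⟨by rw [prodEquiv_fst]; exact hq, trivial⟩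
  map_target' p hp := by
    rw [Set.mem_preimage, ← prodEquiv_fst lam s hs, Equiv.apply_symm_apply]
    exact hp.1
  left_inv' q _ := (prodEquiv lam s hs).symm_apply_apply q
  right_inv' p _ := (prodEquiv lam s hs).apply_symm_apply p
  continuousOn_toFun := by
    -- Over an open set, continuity can be tested before passing to the quotient, where the map is
    -- `(g, f) ↦ (gH, lam (s(gH)⁻¹ g) f)`.
    rw [(isQuotientMap_mk lam).continuousOn_isOpen_iff (hU.preimage (continuous_proj lam))]
    have hfst : ContinuousOn (fun p : G × V => s p.1) {p : G × V | (p.1 : G ⧸ H) ∈ U} :=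
      hsU.comp (continuous_quotient_mk'.comp continuous_fst).continuousOn fun p hp => hp
    refine (continuous_quotient_mk'.comp continuous_fst).continuousOn.prodMk ?_
    refine (continuous_apply_of_stronglyContinuous hlam).comp_continuousOn
      (ContinuousOn.prodMk ?_ continuousOn_snd)
    exact Topology.IsInducing.subtypeVal.continuousOn_iff.2 (hfst.inv.mul continuousOn_fst)
  continuousOn_invFun := (isQuotientMap_mk lam).continuous.comp_continuousOn
    ((hsU.comp continuousOn_fst fun p hp => hp.1).prodMk continuousOn_snd)
  open_source := hU.preimage (continuous_proj lam)
  open_target := hU.prod isOpen_univ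
  baseSet := U
  open_baseSet := hU
  source_eq := rfl
  target_eq := rfl
  proj_toFun q _ := prodEquiv_fst lam s hs q

theorem isUnitaryTrivialization_trivialization (lam : H →* (V ≃ₗᵢ[ℂ] V))
    (hlam : ∀ f, Continuous fun h => lam h f) (s : G ⧸ H → G) (hs : ∀ x, (s x : G ⧸ H) = x)
    {U : Set (G ⧸ H)} (hU : IsOpen U) (hsU : ContinuousOn s U) :
    IsUnitaryTrivialization (trivialization lam hlam s hs hU hsU) := by
  intro x _
  refine ⟨(fibreIsometry lam x (s x) (hs x)).symm, fun q => ?_⟩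
  obtain ⟨f, rfl⟩ := (fibreIsometry lam x (s x) (hs x)).surjective q
  rw [fibreIsometry_apply, LinearIsometryEquiv.symm_apply_apply]
  exact (prodEquiv lam s hs).right_inv (x, f)

end Topology

end Assoc

/-! ### The spinor bundle and its finite-rank pieces -/

section SpinorBundle

variable {G : Type*} [Group G] {H : Subgroup G} {n : ℕ} {kap : H →* Mp n}
  (hU : ∀ h, kap h ∈ UHat n)

theorem finiteDimensional_fibre (l : ℕ) (x : G ⧸ H) :
    FiniteDimensional ℂ (Assoc.Fibre (spinorRepW kap hU unitaryRep_mem_W l) x) :=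
  (Assoc.refLinear _ x).symm.finiteDimensional

theorem isHilbertSum_fibre (x : G ⧸ H) :
    IsHilbertSum ℂ (fun l : ℕ => Assoc.Fibre (spinorRepW kap hU unitaryRep_mem_W l) x)
      (fun l => inclQFibre kap hU unitaryRep_mem_W x l) := by
  have hfd := finiteDimensional_fibre hU (x := x)
  have hc : ∀ l, CompleteSpace (Assoc.Fibre (spinorRepW kap hU unitaryRep_mem_W l) x) :=
    fun l => FiniteDimensional.complete ℂ _
  refine IsHilbertSum.mk (fun k l hkl v w => ?_) ?_
  · refine (LinearIsometryEquiv.inner_map_map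
      (Assoc.refIsometry (spinorRep kap) x).symm _ _).trans ?_
    exact orthogonalFamily_W hkl (Assoc.refIsometry _ x v) (Assoc.refIsometry _ x w)
  · rw [top_le_iff, Submodule.topologicalClosure_eq_top_iff, Submodule.eq_bot_iff]
    intro q hq
    rw [← (Assoc.refIsometry (spinorRep kap) x).map_eq_zero_iff]
    refine eq_zero_of_inner_hermiteL2_eq_zero fun α => ?_
    -- A vector orthogonal to all the fibres of the `Q_l` is tested against the copies of the
    -- Hermite functions in the fibre; the reference isometry carries this back to `L²(ℝⁿ)`.
    have h1 := hq (inclQFibre kap hU unitaryRep_mem_W x (∑ j, α j)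
      ((Assoc.refIsometry _ x).symm ⟨hermiteL2 α, hermiteL2_mem_W α⟩))
      (Submodule.mem_iSup_of_mem (∑ j, α j) ⟨_, rfl⟩)
    rw [← h1, ← LinearIsometryEquiv.inner_map_map (Assoc.refIsometry (spinorRep kap) x)]
    congr 1
    change _ = Assoc.refIsometry (spinorRep kap) x ((Assoc.refIsometry (spinorRep kap) x).symm
      ((Assoc.refIsometry _ x ((Assoc.refIsometry _ x).symm _) : W n _) : L2 n))
    rw [LinearIsometryEquiv.apply_symm_apply, LinearIsometryEquiv.apply_symm_apply]

variable [TopologicalSpace G]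

/-- The topology of `Mp n` is induced by `ρ` and the strong operator topology, so evaluation at `f`
is continuous on it. -/
theorem continuous_spinorRep (hkap : Continuous kap) (f : L2 n) :
    Continuous fun h => spinorRep kap h f := by
  have h1 : Continuous fun q : Mp n => (Mp.rho q, fun f : L2 n => Mp.rep q f) :=
    continuous_induced_dom
  exact (continuous_apply f).comp (continuous_snd.comp (h1.comp hkap))

theorem continuous_spinorRepW (hkap : Continuous kap) (l : ℕ) (w : W n l) :
    Continuous fun h => spinorRepW kap hU unitaryRep_mem_W l h w :=
  (continuous_spinorRep hkap (w : L2 n)).subtype_mk _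

/-- The orthogonal projection onto `𝔚_l` is an equivariant left inverse of the inclusion: a unitary
operator that, with its inverse, preserves a subspace commutes with the projection onto it. -/
theorem isClosedEmbedding_inclQ (l : ℕ) :
    IsClosedEmbedding (inclQ kap hU unitaryRep_mem_W l) := by
  refine Assoc.isClosedEmbedding_map _ _ (W n l).orthogonalProjectionOnto (fun h f => ?_)
    fun w => Submodule.orthogonalProjectionOnto_mem_subspace_eq_self w
  refine Subtype.ext (Submodule.eq_starProjection_of_mem_of_inner_eq_zero (Subtype.coe_prop _)
    fun w hw => ?_)
  have h1 : ((spinorRepW kap hU unitaryRep_mem_W l h ((W n l).orthogonalProjectionOnto f) :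
      W n l) : L2 n) = spinorRep kap h ((W n l).orthogonalProjectionOnto f : L2 n) := rfl
  have h2 : (spinorRep kap h (spinorRepW kap hU unitaryRep_mem_W l h⁻¹ ⟨w, hw⟩ : L2 n)) = w := by
    have : spinorRep kap h (spinorRep kap h⁻¹ w) = w := by
      rw [map_inv]
      exact (spinorRep kap h).apply_symm_apply w
    exact this
  rw [h1, ← map_sub, ← h2, LinearIsometryEquiv.inner_map_map]
  exact Submodule.starProjection_inner_eq_zero f _ (Subtype.coe_prop _)

/-- The same section `s` is used for `Q` and for all `Q_l`. This gives a common base set, and by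
equivariance the inclusion of bundles becomes that of `𝔚_l`. -/
theorem exists_trivializations [IsTopologicalGroup G] (hkap : Continuous kap)
    {U : Set (G ⧸ H)} (hUo : IsOpen U) {s : G ⧸ H → G} (hs : ∀ x, (s x : G ⧸ H) = x)
    (hsU : ContinuousOn s U) {x₀ : G ⧸ H} (hx₀ : x₀ ∈ U) :
    ∃ (t : Bundle.Trivialization (L2 n) (Assoc.proj (spinorRep kap)))
      (s : ∀ l : ℕ, Bundle.Trivialization (W n l)
        (Assoc.proj (spinorRepW kap hU unitaryRep_mem_W l))),
      x₀ ∈ t.baseSet ∧ Assoc.IsUnitaryTrivialization t ∧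
      ∀ l : ℕ, (s l).baseSet = t.baseSet ∧ Assoc.IsUnitaryTrivialization (s l) ∧
        ∀ q : Assoc (spinorRepW kap hU unitaryRep_mem_W l),
          Assoc.proj (spinorRepW kap hU unitaryRep_mem_W l) q ∈ t.baseSet →
            t (inclQ kap hU unitaryRep_mem_W l q) =
              (Assoc.proj (spinorRepW kap hU unitaryRep_mem_W l) q, ((s l q).2 : L2 n)) :=
  ⟨Assoc.trivialization _ (continuous_spinorRep hkap) s hs hUo hsU,
    fun l => Assoc.trivialization _ (continuous_spinorRepW hU hkap l) s hs hUo hsU, hx₀,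
    Assoc.isUnitaryTrivialization_trivialization _ _ _ _ _ _, fun l =>
      ⟨rfl, Assoc.isUnitaryTrivialization_trivialization _ _ _ _ _ _, fun q _ =>
        Assoc.prodEquiv_map _ (spinorRepW_equivariant kap hU unitaryRep_mem_W l) s hs q⟩⟩

end SpinorBundle

/-! ### Continuous local sections of the projection onto the quotient -/

section LocalSection

/-- A continuous map that selects a point in every coset meeting an open set `O` induces a
continuous local section of `G → G ⧸ H`. -/
theorem exists_section_of_selection {G : Type*} [Group G] [TopologicalSpace G]
    [IsTopologicalGroup G] {H : Subgroup G} {O : Set G} (hO : IsOpen O) {τ : G → G}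
    (hτ : ContinuousOn τ O) (hτH : ∀ g ∈ O, g⁻¹ * τ g ∈ H)
    (hτO : ∀ g ∈ O, ∀ g' ∈ O, g⁻¹ * g' ∈ H → τ g = τ g') {g₀ : G} (hg₀ : g₀ ∈ O) :
    ∃ (U : Set (G ⧸ H)) (s : G ⧸ H → G), IsOpen U ∧ (g₀ : G ⧸ H) ∈ U ∧
      (∀ x, (s x : G ⧸ H) = x) ∧ ContinuousOn s U := by
  classical
  -- Off the image of `O` an arbitrary representative keeps `s` a section everywhere; continuity is
  -- claimed only on that image.
  let s : G ⧸ H → G := fun x => if h : ∃ g ∈ O, (g : G ⧸ H) = x then τ h.choose else x.out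
  have hs : ∀ g ∈ O, s (g : G ⧸ H) = τ g := by
    intro g hg
    have h : ∃ g' ∈ O, (g' : G ⧸ H) = g := ⟨g, hg, rfl⟩
    simp only [s, dif_pos h]
    exact hτO _ h.choose_spec.1 _ hg (QuotientGroup.eq.1 h.choose_spec.2)
  refine ⟨(fun g : G => (g : G ⧸ H)) '' O, s, QuotientGroup.isOpenMap_coe _ hO, ⟨g₀, hg₀, rfl⟩,
    fun x => ?_, ?_⟩
  · by_cases h : ∃ g ∈ O, (g : G ⧸ H) = x
    · obtain ⟨g, hg, rfl⟩ := h
      rw [hs g hg]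
      exact (QuotientGroup.eq.2 (hτH g hg)).symm
    · simp only [s, dif_neg h]
      exact QuotientGroup.out_eq' x
  · rintro _ ⟨g, hg, rfl⟩
    refine ContinuousAt.continuousWithinAt ?_
    -- The projection is open, so neighbourhoods of a coset are images of neighbourhoods of `g`, and
    -- continuity of `s` reduces to that of `τ`.
    have h1 := (QuotientGroup.isOpenQuotientMap_mk (N := H)).map_nhds_eq g
    rw [ContinuousAt, hs g hg]
    change Filter.Tendsto s (𝓝 ((g : G ⧸ H))) _
    rw [← h1, Filter.tendsto_map'_iff]
    refine ((hτ g hg).continuousAt (hO.mem_nhds hg)).congr' ?_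
    filter_upwards [hO.mem_nhds hg] with g' hg'
    exact (hs g' hg').symm

variable {E : Type*} [NormedAddCommGroup E] [NormedSpace ℝ E] [FiniteDimensional ℝ E]
  {G : Type*} [TopologicalSpace G] [ChartedSpace E G] [Group G] [LieGroup 𝓘(ℝ, E) ∞ G]
  {F : Type*} [NormedAddCommGroup F] [NormedSpace ℝ F]
  {H : Subgroup G} [ChartedSpace F H]

/-- A Lie subgroup has a slice at the unit element. -/
theorem exists_selection
    (hH : IsImmersionAt 𝓘(ℝ, F) 𝓘(ℝ, E) ∞ (Subtype.val : H → G) 1) :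
    ∃ (O : Set G) (τ : G → G), IsOpen O ∧ (1 : G) ∈ O ∧ ContinuousOn τ O ∧
      (∀ g ∈ O, g⁻¹ * τ g ∈ H) ∧ ∀ g ∈ O, ∀ g' ∈ O, g⁻¹ * g' ∈ H → τ g = τ g' := by
  have : IsTopologicalGroup G := topologicalGroup_of_lieGroup 𝓘(ℝ, E) ∞
  obtain ⟨C, _, _, hC⟩ := hH
  set φ : OpenPartialHomeomorph H F := hC.domChart
  set ψ : OpenPartialHomeomorph G E := hC.codChart
  set e : (F × C) ≃L[ℝ] E := hC.equiv
  have hφ : φ ∈ IsManifold.maximalAtlas 𝓘(ℝ, F) ∞ H := hC.domChart_mem_maximalAtlas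
  have hψ : ψ ∈ IsManifold.maximalAtlas 𝓘(ℝ, E) ∞ G := hC.codChart_mem_maximalAtlas
  have h1φ : (1 : H) ∈ φ.source := hC.mem_domChart_source
  have h1ψ : (1 : G) ∈ ψ.source := hC.mem_codChart_source
  have hw : ∀ u ∈ φ.target, ψ (φ.symm u : G) = e (u, 0) := fun u hu => by
    simpa using hC.writtenInCharts (show u ∈ (hC.domChart.extend 𝓘(ℝ, F)).target by simpa using hu)
  have hfd : FiniteDimensional ℝ (F × C) := e.symm.toLinearEquiv.finiteDimensional
  have hcs : CompleteSpace (F × C) := FiniteDimensional.complete ℝ _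
  set f₀ : F := φ 1
  have hf₀ : f₀ ∈ φ.target := φ.map_source h1φ
  have hf₀s : φ.symm f₀ = 1 := φ.left_inv h1φ
  have he0 : e (f₀, 0) = ψ 1 := by rw [← hw f₀ hf₀, hf₀s]; rfl
  -- In the adapted charts `H` is the `F`-direction of `F × C` near `1`; `σ` runs through the
  -- complementary direction.
  set σ : C → G := fun c => ψ.symm (e (f₀, c))
  have hσ0 : σ 0 = 1 := by simp only [σ, he0]; exact ψ.left_inv h1ψ
  set Ψ : F × C → G := fun p => σ p.2 * (φ.symm p.1 : G)
  have hΨ0 : Ψ (f₀, 0) = 1 := by simp [Ψ, hσ0, hf₀s]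
  have hσm : ContMDiffAt 𝓘(ℝ, C) 𝓘(ℝ, E) ∞ σ 0 := by
    have h1 := contMDiffAt_symm_of_mem_maximalAtlas hψ (ψ.map_source h1ψ)
    rw [← he0] at h1
    have h2 : ContDiff ℝ ∞ fun c : C => e (f₀, c) := by fun_prop
    exact h1.comp 0 h2.contMDiff.contMDiffAt
  have hφm : ContMDiffAt 𝓘(ℝ, F) 𝓘(ℝ, E) ∞ (fun u => (φ.symm u : G)) f₀ := by
    have h1 := hC.contMDiffAt
    rw [← hf₀s] at h1
    exact h1.comp f₀ (contMDiffAt_symm_of_mem_maximalAtlas hφ hf₀)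
  have hΨm : ContMDiffAt 𝓘(ℝ, F × C) 𝓘(ℝ, E) ∞ Ψ (f₀, 0) := by
    have h1 : ContMDiffAt 𝓘(ℝ, F × C) 𝓘(ℝ, E) ∞ (fun p : F × C => σ p.2) (f₀, 0) :=
      ContMDiffAt.comp (g := σ) (f := Prod.snd) (f₀, (0 : C)) hσm contDiff_snd.contMDiff.contMDiffAt
    have h2 : ContMDiffAt 𝓘(ℝ, F × C) 𝓘(ℝ, E) ∞ (fun p : F × C => (φ.symm p.1 : G)) (f₀, 0) :=
      ContMDiffAt.comp (g := fun u => (φ.symm u : G)) (f := Prod.fst) (f₀, (0 : C)) hφm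
        contDiff_fst.contMDiff.contMDiffAt
    exact h1.mul h2
  have hΦm : ContDiffAt ℝ ∞ (ψ ∘ Ψ) (f₀, 0) := by
    have h1 := contMDiffAt_of_mem_maximalAtlas hψ h1ψ
    rw [← hΨ0] at h1
    exact contMDiffAt_iff_contDiffAt.1 (h1.comp _ hΨm)
  have hinl : ∀ᶠ u in 𝓝 f₀, (ψ ∘ Ψ) (u, 0) = e (u, 0) := by
    filter_upwards [φ.open_target.mem_nhds hf₀] with u hu
    simp [Ψ, hσ0, hw u hu]
  have htgt : ∀ᶠ c in 𝓝 (0 : C), e (f₀, c) ∈ ψ.target := by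
    have : Filter.Tendsto (fun c : C => e (f₀, c)) (𝓝 0) (𝓝 (ψ 1)) := by
      rw [← he0]
      exact Continuous.tendsto (by fun_prop) _
    exact this (ψ.open_target.mem_nhds (ψ.map_source h1ψ))
  have hinr : ∀ᶠ c in 𝓝 (0 : C), (ψ ∘ Ψ) (f₀, c) = e (f₀, c) := by
    filter_upwards [htgt] with c hc
    simp [Ψ, hf₀s, σ, ψ.right_inv hc]
  -- In the chart, `Ψ(u, c) = σ(c) φ⁻¹(u)` agrees with `e` along both axes through the base point.
  -- Hence its derivative there is the isomorphism `e`, and the inverse function theorem applies.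
  have hderiv : HasStrictFDerivAt (ψ ∘ Ψ) (e : (F × C) →L[ℝ] E) (f₀, 0) := by
    have h1 := hΦm.hasStrictFDerivAt (by simp)
    have h2 := h1.hasFDerivAt
    have hl := h2.comp f₀ (hasFDerivAt_prodMk_left (𝕜 := ℝ) f₀ (0 : C))
    have hr := h2.comp (0 : C) (hasFDerivAt_prodMk_right (𝕜 := ℝ) f₀ (0 : C))
    have hl' : HasFDerivAt (fun u => (ψ ∘ Ψ) (u, (0 : C)))
        ((e : (F × C) →L[ℝ] E).comp (ContinuousLinearMap.inl ℝ F C)) f₀ :=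
      ((e : (F × C) →L[ℝ] E).hasFDerivAt.comp f₀
        (hasFDerivAt_prodMk_left (𝕜 := ℝ) f₀ (0 : C))).congr_of_eventuallyEq hinl
    have hr' : HasFDerivAt (fun c => (ψ ∘ Ψ) (f₀, c))
        ((e : (F × C) →L[ℝ] E).comp (ContinuousLinearMap.inr ℝ F C)) 0 :=
      ((e : (F × C) →L[ℝ] E).hasFDerivAt.comp (0 : C)
        (hasFDerivAt_prodMk_right (𝕜 := ℝ) f₀ (0 : C))).congr_of_eventuallyEq hinr
    have heq : fderiv ℝ (ψ ∘ Ψ) (f₀, 0) = e :=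
      ContinuousLinearMap.prod_ext (hl.unique hl') (hr.unique hr')
    rwa [heq] at h1
  set P := hderiv.toOpenPartialHomeomorph (ψ ∘ Ψ)
  have hP : ∀ p, P p = ψ (Ψ p) := fun p => rfl
  have hP0 : (f₀, (0 : C)) ∈ P.source := hderiv.mem_toOpenPartialHomeomorph_source
  have hN : ∀ᶠ p in 𝓝 (f₀, (0 : C)), p ∈ P.source ∧ p.1 ∈ φ.target ∧ Ψ p ∈ ψ.source ∧
      e (f₀, p.2) ∈ ψ.target := by
    have h1 : ∀ᶠ p in 𝓝 (f₀, (0 : C)), p ∈ P.source := P.open_source.mem_nhds hP0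
    have h2 : ∀ᶠ p in 𝓝 (f₀, (0 : C)), p.1 ∈ φ.target :=
      continuousAt_fst (φ.open_target.mem_nhds hf₀)
    have h3 : ∀ᶠ p in 𝓝 (f₀, (0 : C)), Ψ p ∈ ψ.source :=
      hΨm.continuousAt (ψ.open_source.mem_nhds (by rwa [hΨ0]))
    have h4 : ∀ᶠ p in 𝓝 (f₀, (0 : C)), e (f₀, p.2) ∈ ψ.target :=
      (continuousAt_snd (p := (f₀, (0 : C)))).eventually htgt
    exact h1.and (h2.and (h3.and h4))
  obtain ⟨F₁, C₁, hF₁, hf₀F, hC₁, h0C, hFC⟩ := mem_nhds_prod_iff'.1 hN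
  -- `H` has the subspace topology, so every point of `H` in some neighbourhood `T` of `1` in `G`
  -- lies in the chart of `H`: no other sheet of `H` comes back near `1`.
  obtain ⟨T, hT, hTF⟩ := isOpen_induced_iff.1 (φ.isOpen_inter_preimage hF₁)
  have h1T : (1 : G) ∈ T := by
    have : (1 : H) ∈ Subtype.val ⁻¹' T := by rw [hTF]; exact ⟨h1φ, hf₀F⟩
    exact this
  have hD : ∀ᶠ p in 𝓝 ((0 : C), (0 : C)), (σ p.2)⁻¹ * σ p.1 ∈ T := by
    have h1 : ContinuousAt (fun p : C × C => (σ p.2)⁻¹ * σ p.1) ((0 : C), (0 : C)) :=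
      (ContinuousAt.comp (x := ((0 : C), (0 : C))) hσm.continuousAt continuousAt_snd).inv.mul
        (ContinuousAt.comp (x := ((0 : C), (0 : C))) hσm.continuousAt continuousAt_fst)
    exact h1 (hT.mem_nhds (by simpa [hσ0] using h1T))
  obtain ⟨C₂, C₃, hC₂, h0C₂, hC₃, h0C₃, hCC⟩ := mem_nhds_prod_iff'.1 hD
  set C' : Set C := C₁ ∩ (C₂ ∩ C₃)
  have hC' : IsOpen C' := hC₁.inter (hC₂.inter hC₃)
  -- Each coset meets the slice at most once: `k = σ(c')⁻¹ σ(c)` lies in `T`, so `Ψ(φ k, c') = σ(c)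
  -- = Ψ(f₀, c)` inside the domain where `Ψ` is injective.
  have hinj : ∀ c ∈ C', ∀ c' ∈ C', (σ c')⁻¹ * σ c ∈ H → c = c' := by
    intro c hc c' hc' hk
    set k : H := ⟨_, hk⟩
    have hkT : k ∈ Subtype.val ⁻¹' T := hCC (Set.mk_mem_prod hc.2.1 hc'.2.2)
    rw [hTF] at hkT
    have h1 := hFC (Set.mk_mem_prod hkT.2 hc'.1)
    have h2 := hFC (Set.mk_mem_prod hf₀F hc.1)
    have h3 : P (φ k, c') = P (f₀, c) := by
      simp [hP, Ψ, hf₀s, φ.left_inv hkT.1, k]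
    exact (congrArg Prod.snd (P.injOn h1.1 h2.1 h3)).symm
  set O : Set G := ψ.source ∩ ψ ⁻¹' (P.target ∩ P.symm ⁻¹' (F₁ ×ˢ C'))
  have hO : IsOpen O :=
    ψ.isOpen_inter_preimage (P.symm.isOpen_inter_preimage (hF₁.prod hC'))
  have hPO : ∀ g ∈ O, Ψ (P.symm (ψ g)) = g := by
    intro g hg
    have h1 := hFC (Set.mk_mem_prod hg.2.2.1 hg.2.2.2.1)
    exact ψ.injOn h1.2.2.1 hg.1 (P.right_inv hg.2.1)
  -- Near `1` each `g` factors as `σ(c) h` with `h ∈ H`; the selected point of `g H` is `σ(c)`.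
  refine ⟨O, fun g => σ (P.symm (ψ g)).2, hO, ?_, ?_, ?_, ?_⟩
  · have h1 : ψ 1 = P (f₀, 0) := by rw [hP, hΨ0]
    refine ⟨h1ψ, ?_⟩
    rw [Set.mem_preimage, h1]
    refine ⟨P.map_source hP0, ?_⟩
    rw [Set.mem_preimage, P.left_inv hP0]
    exact ⟨hf₀F, h0C, h0C₂, h0C₃⟩
  · have h1 : ContinuousOn (fun g => (P.symm (ψ g)).2) O :=
      continuous_snd.comp_continuousOn
        (P.symm.continuousOn.comp (ψ.continuousOn.mono fun g hg => hg.1) fun g hg => hg.2.1)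
    have h2 : ContinuousOn σ C' :=
      ψ.symm.continuousOn.comp (Continuous.continuousOn (by fun_prop)) fun c hc =>
        (hFC (Set.mk_mem_prod hf₀F hc.1)).2.2.2
    exact h2.comp h1 fun g hg => hg.2.2.2
  · intro g hg
    have h1 : g⁻¹ * σ (P.symm (ψ g)).2 = ((φ.symm (P.symm (ψ g)).1)⁻¹ : H) := by
      rw [inv_mul_eq_iff_eq_mul, Subgroup.coe_inv, eq_mul_inv_iff_mul_eq]
      exact hPO g hg
    rw [h1]
    exact Subtype.coe_prop _
  · intro g hg g' hg' hgg
    refine congrArg σ (hinj _ hg.2.2.2 _ hg'.2.2.2 ?_)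
    have h1 : (σ (P.symm (ψ g')).2)⁻¹ * σ (P.symm (ψ g)).2 =
        (φ.symm (P.symm (ψ g')).1 : G) * (g⁻¹ * g')⁻¹ * (φ.symm (P.symm (ψ g)).1 : G)⁻¹ := by
      have h2 := hPO g hg
      have h3 := hPO g' hg'
      simp only [Ψ] at h2 h3
      rw [eq_mul_inv_iff_mul_eq, mul_assoc, h2, inv_mul_eq_iff_eq_mul, ← mul_assoc, h3]
      group
    rw [h1]
    exact H.mul_mem (H.mul_mem (Subtype.coe_prop _) (H.inv_mem hgg))
      (H.inv_mem (Subtype.coe_prop _))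

/-- The projection `G → G ⧸ H` has continuous local sections. -/
theorem exists_section
    (hH : IsImmersionAt 𝓘(ℝ, F) 𝓘(ℝ, E) ∞ (Subtype.val : H → G) 1) (x₀ : G ⧸ H) :
    ∃ (U : Set (G ⧸ H)) (s : G ⧸ H → G), IsOpen U ∧ x₀ ∈ U ∧
      (∀ x, (s x : G ⧸ H) = x) ∧ ContinuousOn s U := by
  have : IsTopologicalGroup G := topologicalGroup_of_lieGroup 𝓘(ℝ, E) ∞
  obtain ⟨O, τ, hO, h1O, hτ, hτH, hτO⟩ := exists_selection hH
  obtain ⟨g₀, rfl⟩ := QuotientGroup.mk_surjective x₀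
  have hcont : Continuous fun g : G => g₀⁻¹ * g := continuous_const_mul _
  refine exists_section_of_selection (O := (fun g => g₀⁻¹ * g) ⁻¹' O)
    (τ := fun g => g₀ * τ (g₀⁻¹ * g)) (hO.preimage hcont) ?_ ?_ ?_ (by simpa using h1O)
  · exact continuousOn_const.mul (hτ.comp hcont.continuousOn fun g hg => hg)
  · intro g hg
    simpa [mul_assoc] using hτH _ hg
  · intro g hg g' hg' hgg
    exact congrArg (g₀ * ·) (hτO _ hg _ hg' (by simpa [mul_assoc] using hgg))

end LocalSection

/-! ### The derivative of the adjoint representation -/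

section Adjoint

variable {E : Type*} [NormedAddCommGroup E] [NormedSpace ℝ E]

/-- The derivative of the adjoint action in terms of a local group law `μ` and of the corresponding
local conjugation `c`. -/
theorem hasFDerivAt_localConj {μ c : E × E → E} {e : E} (hμ : ContDiffAt ℝ 2 μ (e, e))
    (hc : ContDiffAt ℝ 2 c (e, e)) (hμr : ∀ᶠ x in 𝓝 e, μ (x, e) = x)
    (hce : ∀ᶠ x in 𝓝 e, c (x, e) = e) (hec : ∀ᶠ y in 𝓝 e, c (e, y) = y)
    (hμl : ∀ᶠ y in 𝓝 e, μ (e, y) = y)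
    (hμc : ∀ᶠ p in 𝓝 (e, e), μ (c p, p.1) = μ p) (X : E) :
    ∃ L : E →L[ℝ] E, HasFDerivAt (fun x => fderiv ℝ c (x, e) (0, X)) L e ∧ ∀ Z, L Z =
      VectorField.lieBracket ℝ (fun x => fderiv ℝ μ (x, e) (0, Z))
        (fun x => fderiv ℝ μ (x, e) (0, X)) e := by
  have hM : DifferentiableAt ℝ (fderiv ℝ μ) (e, e) :=
    (hμ.fderiv_right (m := 1) (by norm_num)).differentiableAt (by norm_num)
  have hN : DifferentiableAt ℝ (fderiv ℝ c) (e, e) :=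
    (hc.fderiv_right (m := 1) (by norm_num)).differentiableAt (by norm_num)
  set D := fderiv ℝ (fderiv ℝ μ) (e, e)
  have hsymm : ∀ v w, D v w = D w v := fun v w =>
    (hμ.isSymmSndFDerivAt (by simp)) v w
  have hl : HasFDerivAt (fun x : E => (x, e)) (ContinuousLinearMap.inl ℝ E E) e :=
    hasFDerivAt_prodMk_left e e
  have hr : HasFDerivAt (fun x : E => (e, x)) (ContinuousLinearMap.inr ℝ E E) e :=
    hasFDerivAt_prodMk_right e e
  have hV : ∀ Y : E, HasFDerivAt (fun x => fderiv ℝ μ (x, e) (0, Y))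
      ((D.comp (ContinuousLinearMap.inl ℝ E E)).flip (0, Y)) e := fun Y => by
    simpa using (HasFDerivAt.comp (f := fun x => (x, e)) e hM.hasFDerivAt hl).clm_apply
      (hasFDerivAt_const ((0 : E), Y) e)
  have hC : HasFDerivAt (fun x => fderiv ℝ c (x, e) (0, X))
      (((fderiv ℝ (fderiv ℝ c) (e, e)).comp (ContinuousLinearMap.inl ℝ E E)).flip (0, X)) e := by
    simpa using (HasFDerivAt.comp (f := fun x => (x, e)) e hN.hasFDerivAt hl).clm_apply
      (hasFDerivAt_const ((0 : E), X) e)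
  set L := ((fderiv ℝ (fderiv ℝ c) (e, e)).comp (ContinuousLinearMap.inl ℝ E E)).flip (0, X)
  refine ⟨L, hC, fun Z => ?_⟩
  have hμd : ∀ᶠ p in 𝓝 (e, e), DifferentiableAt ℝ μ p :=
    (hμ.eventually (by simp)).mono fun p hp => hp.differentiableAt (by norm_num)
  have hcd : ∀ᶠ p in 𝓝 (e, e), DifferentiableAt ℝ c p :=
    (hc.eventually (by simp)).mono fun p hp => hp.differentiableAt (by norm_num)
  have hMl : ∀ u, fderiv ℝ μ (e, e) (u, 0) = u := fun u => by
    have h1 := (HasFDerivAt.comp (f := fun x => (x, e)) e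
      (hμ.differentiableAt (by norm_num)).hasFDerivAt hl)
    have h2 := h1.unique ((hasFDerivAt_id e).congr_of_eventuallyEq hμr)
    exact congrArg (fun T : E →L[ℝ] E => T u) h2
  have hMr : ∀ u, fderiv ℝ μ (e, e) (0, u) = u := fun u => by
    have h1 := (HasFDerivAt.comp (f := fun x => (e, x)) e
      (hμ.differentiableAt (by norm_num)).hasFDerivAt hr)
    have h2 := h1.unique ((hasFDerivAt_id e).congr_of_eventuallyEq hμl)
    exact congrArg (fun T : E →L[ℝ] E => T u) h2
  have hCe : fderiv ℝ c (e, e) (0, X) = X := by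
    have h1 := (HasFDerivAt.comp (f := fun x => (e, x)) e
      (hc.differentiableAt (by norm_num)).hasFDerivAt hr)
    have h2 := h1.unique ((hasFDerivAt_id e).congr_of_eventuallyEq hec)
    exact congrArg (fun T : E →L[ℝ] E => T X) h2
  have htl : Filter.Tendsto (fun x : E => (x, e)) (𝓝 e) (𝓝 (e, e)) := hl.continuousAt
  have htr : Filter.Tendsto (fun x : E => (e, x)) (𝓝 e) (𝓝 (e, e)) := hr.continuousAt
  -- Differentiating `μ (c (x, y), x) = μ (x, y)` in `y` at `e` compares the right-invariant field
  -- of `Ad(x) X` with the left-invariant field of `X`.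
  have hkey : ∀ᶠ x in 𝓝 e, fderiv ℝ μ (e, x) (fderiv ℝ c (x, e) (0, X), 0) =
      fderiv ℝ μ (x, e) (0, X) := by
    filter_upwards [hce, htl.eventually hμc.eventually_nhds, htl.eventually hμd,
      htr.eventually hμd, htl.eventually hcd] with x h1 h2 h3 h4 h5
    have hr' : HasFDerivAt (fun y : E => (x, y)) (ContinuousLinearMap.inr ℝ E E) e :=
      hasFDerivAt_prodMk_right x e
    have h6 := HasFDerivAt.comp e h3.hasFDerivAt hr'
    have h7 : HasFDerivAt (fun y : E => (c (x, y), x))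
        (((fderiv ℝ c (x, e)).comp (ContinuousLinearMap.inr ℝ E E)).prod 0) e :=
      (HasFDerivAt.comp e h5.hasFDerivAt hr').prodMk (hasFDerivAt_const x e)
    have h4' : HasFDerivAt μ (fderiv ℝ μ (e, x)) (c (x, e), x) := by
      rw [h1]; exact h4.hasFDerivAt
    have h8 := HasFDerivAt.comp e h4' h7
    have h9 := h8.unique (h6.congr_of_eventuallyEq
      ((hr'.continuousAt.tendsto.eventually h2).mono fun y hy => hy))
    simpa using congrArg (fun T : E →L[ℝ] E => T X) h9
  have h1 : HasFDerivAt (fun x => fderiv ℝ μ (e, x) (fderiv ℝ c (x, e) (0, X), 0)) _ e :=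
    (HasFDerivAt.comp (f := fun x => (e, x)) e hM.hasFDerivAt hr).clm_apply
      (hC.prodMk (hasFDerivAt_const (0 : E) e))
  -- Differentiating once more, in `x` along `Z`, gives `D (0, Z) (X, 0) + L Z = D (Z, 0) (0, X)`.
  -- Symmetry of `D` turns this into the bracket of the left-invariant fields.
  have h2 := congrArg (fun T : E →L[ℝ] E => T Z)
    (h1.unique ((hV X).congr_of_eventuallyEq hkey))
  simp [hMl, hCe] at h2
  rw [VectorField.lieBracket, (hV X).fderiv, (hV Z).fderiv, hMr, hMr]
  simp
  rw [← h2, hsymm (X, 0)]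
  abel

variable {G : Type*} [TopologicalSpace G] [ChartedSpace E G]

/-- The derivative of a vector-valued function at the base point of a chart, in that chart. -/
theorem mfderiv_eq_fderiv_chart {E' : Type*} [NormedAddCommGroup E'] [NormedSpace ℝ E']
    {f : G → E'} {g : G} (hf : MDifferentiableAt 𝓘(ℝ, E) 𝓘(ℝ, E') f g) :
    (mfderiv 𝓘(ℝ, E) 𝓘(ℝ, E') f g : E →L[ℝ] E') =
      fderiv ℝ (f ∘ (extChartAt 𝓘(ℝ, E) g).symm) (extChartAt 𝓘(ℝ, E) g g) := by
  rw [hf.mfderiv, ← fderivWithin_univ]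
  simp [writtenInExtChartAt]
  rfl

variable [Group G]

variable (E G) in
theorem symm_extChartAt_one :
    (extChartAt 𝓘(ℝ, E) (1 : G)).symm (extChartAt 𝓘(ℝ, E) (1 : G) 1) = 1 :=
  extChartAt_to_inv 1

variable [LieGroup 𝓘(ℝ, E) ∞ G]

variable (E G) in
/-- The multiplication of `G` in the chart around the unit element. -/
def localMul (p : E × E) : E :=
  extChartAt 𝓘(ℝ, E) (1 : G)
    ((extChartAt 𝓘(ℝ, E) (1 : G)).symm p.1 * (extChartAt 𝓘(ℝ, E) (1 : G)).symm p.2)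

variable (E G) in
/-- The conjugation of `G` in the chart around the unit element. -/
def localConj (p : E × E) : E :=
  extChartAt 𝓘(ℝ, E) (1 : G)
    ((extChartAt 𝓘(ℝ, E) (1 : G)).symm p.1 * (extChartAt 𝓘(ℝ, E) (1 : G)).symm p.2 *
      ((extChartAt 𝓘(ℝ, E) (1 : G)).symm p.1)⁻¹)

variable (E G) in
theorem contMDiffAt_symm_extChartAt_one :
    ContMDiffAt 𝓘(ℝ, E) 𝓘(ℝ, E) ∞ (extChartAt 𝓘(ℝ, E) (1 : G)).symm
      (extChartAt 𝓘(ℝ, E) (1 : G) 1) := by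
  have := contMDiffWithinAt_extChartAt_symm_range (I := 𝓘(ℝ, E)) (n := ∞) (1 : G)
    (mem_extChartAt_target (I := 𝓘(ℝ, E)) (1 : G))
  rwa [modelWithCornersSelf_coe, Set.range_id, contMDiffWithinAt_univ] at this

variable (E G) in
theorem contDiffAt_localMul : ContDiffAt ℝ ∞ (localMul E G)
    (extChartAt 𝓘(ℝ, E) (1 : G) 1, extChartAt 𝓘(ℝ, E) (1 : G) 1) := by
  set e := extChartAt 𝓘(ℝ, E) (1 : G) 1
  have h := contMDiffAt_symm_extChartAt_one E G
  have h1 := ContMDiffAt.comp (f := Prod.fst) (e, e) h contDiff_fst.contMDiff.contMDiffAt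
  have h2 := ContMDiffAt.comp (f := Prod.snd) (e, e) h contDiff_snd.contMDiff.contMDiffAt
  have h3 := h1.mul h2
  refine contMDiffAt_iff_contDiffAt.1 (ContMDiffAt.comp_of_eq
    (contMDiffAt_extChartAt (I := 𝓘(ℝ, E)) (x := (1 : G))) h3 ?_)
  simp [e, symm_extChartAt_one, -extChartAt]

variable (E G) in
theorem contDiffAt_localConj : ContDiffAt ℝ ∞ (localConj E G)
    (extChartAt 𝓘(ℝ, E) (1 : G) 1, extChartAt 𝓘(ℝ, E) (1 : G) 1) := by
  set e := extChartAt 𝓘(ℝ, E) (1 : G) 1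
  have h := contMDiffAt_symm_extChartAt_one E G
  have h1 := ContMDiffAt.comp (f := Prod.fst) (e, e) h contDiff_fst.contMDiff.contMDiffAt
  have h2 := ContMDiffAt.comp (f := Prod.snd) (e, e) h contDiff_snd.contMDiff.contMDiffAt
  have h3 := (h1.mul h2).mul h1.inv
  refine contMDiffAt_iff_contDiffAt.1 (ContMDiffAt.comp_of_eq
    (contMDiffAt_extChartAt (I := 𝓘(ℝ, E)) (x := (1 : G))) h3 ?_)
  simp [e, symm_extChartAt_one, -extChartAt]

/-- The left-invariant vector fields in the chart around the unit element. -/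
theorem mpullbackWithin_mulInvariantVectorField (X : GroupLieAlgebra 𝓘(ℝ, E) G) :
    ∀ᶠ x in 𝓝 (extChartAt 𝓘(ℝ, E) (1 : G) 1),
      (VectorField.mpullbackWithin 𝓘(ℝ, E) 𝓘(ℝ, E) (extChartAt 𝓘(ℝ, E) (1 : G)).symm
        (mulInvariantVectorField X) Set.univ x : E) =
      fderiv ℝ (localMul E G) (x, extChartAt 𝓘(ℝ, E) (1 : G) 1) ((0 : E), (X : E)) := by
  set φ := extChartAt 𝓘(ℝ, E) (1 : G)
  set e := φ 1
  have hl : ContinuousAt (fun x : E => (x, e)) e := by fun_prop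
  have hd : ∀ᶠ x in 𝓝 e, DifferentiableAt ℝ (localMul E G) (x, e) :=
    hl.eventually (((contDiffAt_localMul E G).of_le (m := 1) (by simp)).eventually
      (by simp) |>.mono fun p hp => hp.differentiableAt (by simp))
  have htarget : ∀ᶠ x in 𝓝 e, x ∈ φ.target := extChartAt_target_mem_nhds (I := 𝓘(ℝ, E)) (1 : G)
  filter_upwards [htarget, hd] with x hx hdx
  set g : G := φ.symm x
  have hg : g ∈ φ.source := φ.map_target hx
  have hgx : φ g = x := φ.right_inv hx
  have hinv : (mfderivWithin 𝓘(ℝ, E) 𝓘(ℝ, E) φ.symm Set.univ x).inverse =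
      mfderiv 𝓘(ℝ, E) 𝓘(ℝ, E) φ g := by
    apply ContinuousLinearMap.inverse_eq
    · have := mfderivWithin_extChartAt_symm_comp_mfderiv_extChartAt (I := 𝓘(ℝ, E)) hx
      rw [modelWithCornersSelf_coe, Set.range_id] at this
      exact this
    · have := mfderiv_extChartAt_comp_mfderivWithin_extChartAt_symm (I := 𝓘(ℝ, E)) hx
      rw [modelWithCornersSelf_coe, Set.range_id] at this
      exact this
  have hφd : MDifferentiableAt 𝓘(ℝ, E) 𝓘(ℝ, E) φ (g * 1) := by
    rw [mul_one]
    exact mdifferentiableAt_extChartAt (by simpa [φ] using hg)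
  have hLd : MDifferentiableAt 𝓘(ℝ, E) 𝓘(ℝ, E) (fun y : G => g * y) 1 :=
    (contMDiff_mul_left (I := 𝓘(ℝ, E)) (n := ∞)).mdifferentiableAt (by simp)
  have h1 : (mfderiv 𝓘(ℝ, E) 𝓘(ℝ, E) (φ ∘ fun y : G => g * y) 1 : E →L[ℝ] E) X =
      (mfderiv 𝓘(ℝ, E) 𝓘(ℝ, E) φ g : E →L[ℝ] E)
        ((mfderiv 𝓘(ℝ, E) 𝓘(ℝ, E) (fun y : G => g * y) 1 : E →L[ℝ] E) X) := by
    rw [mfderiv_comp (1 : G) hφd hLd]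
    exact congrArg (fun y : G => (mfderiv 𝓘(ℝ, E) 𝓘(ℝ, E) φ y : E →L[ℝ] E)
      ((mfderiv 𝓘(ℝ, E) 𝓘(ℝ, E) (fun y : G => g * y) 1 : E →L[ℝ] E) X)) (mul_one g)
  rw [VectorField.mpullbackWithin_apply, hinv]
  refine h1.symm.trans ?_
  rw [mfderiv_eq_fderiv_chart (hφd.comp (1 : G) hLd)]
  have h2 := (HasFDerivAt.comp (f := fun y => (x, y)) e hdx.hasFDerivAt
    (hasFDerivAt_prodMk_right x e)).fderiv
  refine (congrArg (fun T : E →L[ℝ] E => T X) h2).trans ?_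
  rfl

end Adjoint

section Adjoint

variable {E : Type*} [NormedAddCommGroup E] [NormedSpace ℝ E]
  {G : Type*} [TopologicalSpace G] [ChartedSpace E G] [Group G] [LieGroup 𝓘(ℝ, E) ∞ G]

variable (E G) in
/-- The chart around the unit element has the identity as its derivative there. -/
theorem mfderiv_extChartAt_one : (mfderiv 𝓘(ℝ, E) 𝓘(ℝ, E) (extChartAt 𝓘(ℝ, E) (1 : G)) 1 :
    E →L[ℝ] E) = ContinuousLinearMap.id ℝ E := by
  have h := mfderiv_eq_fderiv_chart
    (mdifferentiableAt_extChartAt (I := 𝓘(ℝ, E)) (mem_chart_source E (1 : G)))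
  refine h.trans ((HasFDerivAt.congr_of_eventuallyEq (hasFDerivAt_id _) ?_).fderiv)
  filter_upwards [extChartAt_target_mem_nhds (I := 𝓘(ℝ, E)) (1 : G)] with x hx
  exact (extChartAt 𝓘(ℝ, E) (1 : G)).right_inv hx

/-- The Lie bracket of `G` in the chart around the unit element. -/
theorem bracket_eq_lieBracket_localMul (Z X : GroupLieAlgebra 𝓘(ℝ, E) G) :
    (⁅Z, X⁆ : GroupLieAlgebra 𝓘(ℝ, E) G) = VectorField.lieBracket ℝ
      (fun x => fderiv ℝ (localMul E G) (x, extChartAt 𝓘(ℝ, E) (1 : G) 1) ((0 : E), (Z : E)))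
      (fun x => fderiv ℝ (localMul E G) (x, extChartAt 𝓘(ℝ, E) (1 : G) 1) ((0 : E), (X : E)))
      (extChartAt 𝓘(ℝ, E) (1 : G) 1) := by
  rw [GroupLieAlgebra.bracket_def, ← VectorField.mlieBracketWithin_univ,
    VectorField.mlieBracketWithin_apply]
  have h1 : (mfderiv 𝓘(ℝ, E) 𝓘(ℝ, E) (extChartAt 𝓘(ℝ, E) (1 : G)) 1 : E →L[ℝ] E).inverse =
      ContinuousLinearMap.id ℝ E := by
    rw [mfderiv_extChartAt_one]
    exact ContinuousLinearMap.inverse_id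
  refine (congrArg (fun T : E →L[ℝ] E => T _) h1).trans ?_
  rw [Set.preimage_univ, Set.univ_inter, modelWithCornersSelf_coe, Set.range_id]
  refine (congrFun VectorField.lieBracketWithin_univ _).trans ?_
  exact Filter.EventuallyEq.lieBracket_vectorField_eq (E := E)
    (mpullbackWithin_mulInvariantVectorField Z) (mpullbackWithin_mulInvariantVectorField X)

/-- The adjoint representation in the chart around the unit element. -/
theorem Ad_symm_extChartAt (X : GroupLieAlgebra 𝓘(ℝ, E) G) :
    ∀ᶠ x in 𝓝 (extChartAt 𝓘(ℝ, E) (1 : G) 1),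
      (Ad ((extChartAt 𝓘(ℝ, E) (1 : G)).symm x) X : E) =
        fderiv ℝ (localConj E G) (x, extChartAt 𝓘(ℝ, E) (1 : G) 1) ((0 : E), (X : E)) := by
  set φ := extChartAt 𝓘(ℝ, E) (1 : G)
  set e := φ 1
  have hl : ContinuousAt (fun x : E => (x, e)) e := by fun_prop
  have hd : ∀ᶠ x in 𝓝 e, DifferentiableAt ℝ (localConj E G) (x, e) :=
    hl.eventually (((contDiffAt_localConj E G).of_le (m := 1) (by simp)).eventually
      (by simp) |>.mono fun p hp => hp.differentiableAt (by simp))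
  filter_upwards [hd] with x hdx
  set g : G := φ.symm x
  have hg1 : g * 1 * g⁻¹ = 1 := by simp
  have hφd : MDifferentiableAt 𝓘(ℝ, E) 𝓘(ℝ, E) φ (g * 1 * g⁻¹) := by
    rw [hg1]
    exact mdifferentiableAt_extChartAt (mem_chart_source E (1 : G))
  have hCd : MDifferentiableAt 𝓘(ℝ, E) 𝓘(ℝ, E) (fun y : G => g * y * g⁻¹) 1 :=
    (((contMDiff_mul_right (I := 𝓘(ℝ, E)) (n := ∞) (a := g⁻¹))).comp
      (contMDiff_mul_left (I := 𝓘(ℝ, E)) (n := ∞) (a := g))).mdifferentiableAt (by simp)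
  have h1 : (mfderiv 𝓘(ℝ, E) 𝓘(ℝ, E) (φ ∘ fun y : G => g * y * g⁻¹) 1 : E →L[ℝ] E) X =
      Ad g X := by
    rw [mfderiv_comp (1 : G) hφd hCd]
    refine (congrArg (fun y : G => (mfderiv 𝓘(ℝ, E) 𝓘(ℝ, E) φ y : E →L[ℝ] E)
      ((mfderiv 𝓘(ℝ, E) 𝓘(ℝ, E) (fun y : G => g * y * g⁻¹) 1 : E →L[ℝ] E) X)) hg1).trans ?_
    exact congrArg (fun T : E →L[ℝ] E => T
      ((mfderiv 𝓘(ℝ, E) 𝓘(ℝ, E) (fun y : G => g * y * g⁻¹) 1 : E →L[ℝ] E) X))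
      (mfderiv_extChartAt_one E G)
  refine h1.symm.trans ?_
  have h3 : (mfderiv 𝓘(ℝ, E) 𝓘(ℝ, E) (φ ∘ fun y : G => g * y * g⁻¹) 1 : E →L[ℝ] E) = _ :=
    mfderiv_eq_fderiv_chart (E' := E) (hφd.comp (1 : G) hCd)
  refine (congrArg (fun T : E →L[ℝ] E => T X) h3).trans ?_
  have h2 := (HasFDerivAt.comp (f := fun y => (x, y)) e hdx.hasFDerivAt
    (hasFDerivAt_prodMk_right x e)).fderiv
  exact congrArg (fun T : E →L[ℝ] E => T X) h2

/-- The derivative of the adjoint representation is the Lie bracket. -/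
theorem exists_hasMFDerivAt_Ad (X : GroupLieAlgebra 𝓘(ℝ, E) G) :
    ∃ L : E →L[ℝ] E, HasMFDerivAt (M' := E) 𝓘(ℝ, E) 𝓘(ℝ, E) (fun g : G => Ad g X) 1 L ∧
      ∀ Z : GroupLieAlgebra 𝓘(ℝ, E) G, L Z = ⁅Z, X⁆ := by
  set φ := extChartAt 𝓘(ℝ, E) (1 : G)
  set e := φ 1
  have htg : Filter.Tendsto φ.symm (𝓝 e) (𝓝 1) := by
    have := (continuousAt_extChartAt_symm (I := 𝓘(ℝ, E)) (1 : G)).tendsto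
    rwa [symm_extChartAt_one] at this
  have hright : ∀ᶠ x in 𝓝 e, φ (φ.symm x) = x := by
    filter_upwards [extChartAt_target_mem_nhds (I := 𝓘(ℝ, E)) (1 : G)] with x hx
    exact φ.right_inv hx
  have hleft : ∀ᶠ g in 𝓝 (1 : G), φ.symm (φ g) = g := by
    filter_upwards [extChartAt_source_mem_nhds (I := 𝓘(ℝ, E)) (1 : G)] with x hx
    exact φ.left_inv hx
  have he1 : φ.symm e = 1 := symm_extChartAt_one E G
  have htop : IsTopologicalGroup G := topologicalGroup_of_lieGroup 𝓘(ℝ, E) ∞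
  have hconj : Filter.Tendsto (fun p : E × E => φ.symm p.1 * φ.symm p.2 * (φ.symm p.1)⁻¹)
      (𝓝 (e, e)) (𝓝 1) := by
    have h1 : Filter.Tendsto (fun p : E × E => φ.symm p.1) (𝓝 (e, e)) (𝓝 1) :=
      htg.comp continuousAt_fst
    have h2 : Filter.Tendsto (fun p : E × E => φ.symm p.2) (𝓝 (e, e)) (𝓝 1) :=
      htg.comp continuousAt_snd
    simpa using (h1.mul h2).mul h1.inv
  obtain ⟨L, hL, hLZ⟩ := hasFDerivAt_localConj (μ := localMul E G) (c := localConj E G) (e := e)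
    ((contDiffAt_localMul E G).of_le (WithTop.coe_le_coe.2 le_top))
    ((contDiffAt_localConj E G).of_le (WithTop.coe_le_coe.2 le_top))
    (hright.mono fun x hx => by
      change φ (φ.symm x * φ.symm e) = x
      rw [he1, mul_one, hx])
    (Filter.Eventually.of_forall fun x => by
      change φ (φ.symm x * φ.symm e * (φ.symm x)⁻¹) = e
      rw [he1, mul_one, mul_inv_cancel])
    (hright.mono fun x hx => by
      change φ (φ.symm e * φ.symm x * (φ.symm e)⁻¹) = x
      rw [he1, one_mul, inv_one, mul_one, hx])
    (hright.mono fun x hx => by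
      change φ (φ.symm e * φ.symm x) = x
      rw [he1, one_mul, hx])
    ((hconj.eventually hleft).mono fun p hp => by
      change φ (φ.symm (φ (φ.symm p.1 * φ.symm p.2 * (φ.symm p.1)⁻¹)) * φ.symm p.1) =
        φ (φ.symm p.1 * φ.symm p.2)
      rw [hp, inv_mul_cancel_right]) X
  refine ⟨L, ?_, fun Z => (hLZ Z).trans (bracket_eq_lieBracket_localMul Z X).symm⟩
  have h1 : HasFDerivAt (F := E) (fun x => (Ad (φ.symm x) X : E)) L e :=
    hL.congr_of_eventuallyEq (Ad_symm_extChartAt X)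
  have h2 : HasMFDerivAt 𝓘(ℝ, E) 𝓘(ℝ, E) φ 1 (ContinuousLinearMap.id ℝ E) := by
    have := (mdifferentiableAt_extChartAt (I := 𝓘(ℝ, E)) (mem_chart_source E (1 : G))).hasMFDerivAt
    rwa [mfderiv_extChartAt_one] at this
  have h3 := HasMFDerivAt.comp (1 : G) h1.hasMFDerivAt h2
  refine (HasMFDerivAt.congr_of_eventuallyEq h3 ?_)
  filter_upwards [hleft] with g hg
  change _ = Ad (φ.symm (φ g)) X
  rw [hg]

end Adjoint

/-! ### Orthogonality of a representation with skew-symmetric derivative -/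

section Constancy

variable {F : Type*} [NormedAddCommGroup F] [NormedSpace ℝ F]
  {M : Type*} [TopologicalSpace M] [ChartedSpace F M]

/-- A function on a connected manifold with vanishing derivative is constant. -/
theorem eq_of_hasMFDerivAt_zero [IsManifold 𝓘(ℝ, F) 1 M] [PreconnectedSpace M] {f : M → ℝ}
    (hf : ∀ x, HasMFDerivAt 𝓘(ℝ, F) 𝓘(ℝ, ℝ) f x (0 : F →L[ℝ] ℝ)) (x y : M) : f x = f y := by
  refine IsLocallyConstant.apply_eq_of_preconnectedSpace
    ((IsLocallyConstant.iff_eventually_eq f).2 fun x => ?_) x y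
  set φ := extChartAt 𝓘(ℝ, F) x
  obtain ⟨r, hr, hball⟩ := Metric.mem_nhds_iff.1 (extChartAt_target_mem_nhds (I := 𝓘(ℝ, F)) x)
  have hd : ∀ z ∈ Metric.ball (φ x) r, HasFDerivAt (f ∘ φ.symm) (0 : F →L[ℝ] ℝ) z := by
    intro z hz
    have h1 := mdifferentiableWithinAt_extChartAt_symm (I := 𝓘(ℝ, F)) (hball hz)
    rw [modelWithCornersSelf_coe, Set.range_id, mdifferentiableWithinAt_univ] at h1
    have h2 := HasMFDerivAt.comp z (hf (φ.symm z)) h1.hasMFDerivAt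
    refine (hasMFDerivAt_iff_hasFDerivAt.1 h2).congr_fderiv ?_
    exact ContinuousLinearMap.zero_comp _
  filter_upwards [extChartAt_source_mem_nhds (I := 𝓘(ℝ, F)) x,
    (continuousAt_extChartAt (I := 𝓘(ℝ, F)) x).preimage_mem_nhds (Metric.ball_mem_nhds _ hr)]
    with y hy hyr
  have h := Metric.isOpen_ball.is_const_of_fderiv_eq_zero
    (convex_ball (φ x) r).isPreconnected
    (fun z hz => (hd z hz).differentiableAt.differentiableWithinAt)
    (fun z hz => (hd z hz).fderiv) hyr (Metric.mem_ball_self hr)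
  simpa only [Function.comp_apply, φ, (extChartAt 𝓘(ℝ, F) x).left_inv hy,
    extChartAt_to_inv] using h

variable [Group M] [LieGroup 𝓘(ℝ, F) ∞ M]

/-- A matrix representation of a connected Lie group is orthogonal if its derivative is
skew-symmetric. -/
theorem mul_transpose_eq_one_of_skew [PreconnectedSpace M] {ι : Type} [Fintype ι] [DecidableEq ι]
    (A : M →* Matrix ι ι ℝ) {b : ι → ι → F →L[ℝ] ℝ}
    (hA : ∀ i j, HasMFDerivAt 𝓘(ℝ, F) 𝓘(ℝ, ℝ) (fun h => A h i j) 1 (b i j))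
    (hb : ∀ i j, b i j + b j i = 0) (h : M) : A h * (A h)ᵀ = 1 := by
  -- Row vectors are used so that `v A(g y) = (v A(g)) A(y)`: a left translation in the group only
  -- changes the vectors `v` and `w`.
  let p (v w : ι → ℝ) (h : M) : ℝ := (v ᵥ* A h) ⬝ᵥ (w ᵥ* A h)
  have hcongr {f g : M → ℝ} {x : M} {a c : F →L[ℝ] ℝ} (h : HasMFDerivAt 𝓘(ℝ, F) 𝓘(ℝ, ℝ) f x a)
      (hfg : f = g) (hac : a = c) : HasMFDerivAt 𝓘(ℝ, F) 𝓘(ℝ, ℝ) g x c := by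
    subst hfg hac
    exact h
  have hvec (v : ι → ℝ) (k : ι) : HasMFDerivAt 𝓘(ℝ, F) 𝓘(ℝ, ℝ) (fun h => (v ᵥ* A h) k) 1
      (∑ i, v i • b i k : F →L[ℝ] ℝ) := by
    have h1 := HasMFDerivAt.sum (t := Finset.univ) fun i _ => (hA i k).const_smul (v i)
    refine hcongr h1 ?_ rfl
    funext h
    simp [Matrix.vecMul, dotProduct]
  have hp1 (v w : ι → ℝ) : HasMFDerivAt 𝓘(ℝ, F) 𝓘(ℝ, ℝ) (p v w) 1 (0 : F →L[ℝ] ℝ) := by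
    have h1 := HasMFDerivAt.sum (t := Finset.univ) fun k _ => (hvec v k).mul (hvec w k)
    refine hcongr h1 ?_ ?_
    · funext h
      simp [p, dotProduct]
    · refine Eq.trans (b := ∑ k, (v k • ∑ i, w i • b i k + w k • ∑ i, v i • b i k)) ?_ ?_
      · simp only [map_one, Matrix.vecMul_one]
        rfl
      · have h2 : ∑ k, w k • ∑ i, v i • b i k = ∑ k, v k • ∑ i, w i • b k i := by
          simp only [Finset.smul_sum]
          rw [Finset.sum_comm]
          exact Finset.sum_congr rfl fun k _ => Finset.sum_congr rfl fun i _ => smul_comm _ _ _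
        rw [Finset.sum_add_distrib, h2, ← Finset.sum_add_distrib]
        refine Finset.sum_eq_zero fun k _ => ?_
        rw [← smul_add, ← Finset.sum_add_distrib, Finset.sum_eq_zero, smul_zero]
        intro i _
        rw [← smul_add, hb, smul_zero]
  have hp (v w : ι → ℝ) (g : M) : HasMFDerivAt 𝓘(ℝ, F) 𝓘(ℝ, ℝ) (p v w) g
      (0 : F →L[ℝ] ℝ) := by
    -- Near `g`, `p v w` is `p (v A(g)) (w A(g))` composed with translation by `g⁻¹`, so vanishing
    -- of all derivatives at `1` gives vanishing everywhere.
    have h1 : MDifferentiableAt 𝓘(ℝ, F) 𝓘(ℝ, F) (fun y : M => g⁻¹ * y) g :=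
      (contMDiff_mul_left (I := 𝓘(ℝ, F)) (n := ∞)).mdifferentiableAt (by simp)
    have h2 : HasMFDerivAt 𝓘(ℝ, F) 𝓘(ℝ, ℝ) (p (v ᵥ* A g) (w ᵥ* A g)) (g⁻¹ * g)
        (0 : F →L[ℝ] ℝ) := by
      rw [inv_mul_cancel]
      exact hp1 _ _
    have h3 := HasMFDerivAt.comp g h2 h1.hasMFDerivAt
    refine hcongr h3 ?_ (ContinuousLinearMap.zero_comp _)
    funext k
    simp only [p, Function.comp_apply, Matrix.vecMul_vecMul, ← map_mul, mul_inv_cancel_left]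
  have : IsManifold 𝓘(ℝ, F) 1 M := IsManifold.of_le (n := ∞) (by simp)
  ext i j
  have h1 := eq_of_hasMFDerivAt_zero (hp (Pi.single i 1) (Pi.single j 1)) h 1
  simpa [p, Matrix.mul_apply, dotProduct, Matrix.one_apply, Pi.single_apply, eq_comm] using h1

end Constancy

/-! ### The isotropy representation is unitary -/

section Isotropy

variable {E : Type*} [NormedAddCommGroup E] [NormedSpace ℝ E]
  {G : Type*} [TopologicalSpace G] [ChartedSpace E G] [Group G]
  {F : Type*} [NormedAddCommGroup F] [NormedSpace ℝ F]
  {H : Subgroup G} [ChartedSpace F H] {D : HermitianSymmetricData E F H}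
  {n : ℕ} {X : Module.Basis (Fin n ⊕ Fin n) ℝ D.m}

/-- A unitary basis is orthonormal. -/
theorem HermitianSymmetricData.IsUnitaryBasis.omega_cplx (hX : D.IsUnitaryBasis X)
    (i j : Fin n ⊕ Fin n) : D.omega (X i) (D.cplx (X j)) = if i = j then 1 else 0 := by
  have h (j : Fin n) : D.cplx (X (Sum.inr j)) = -X (Sum.inl j) := by
    rw [← hX.cplx_inl, D.cplx_cplx]
  rcases i with i | i <;> rcases j with j | j
  · simp [hX.cplx_inl, hX.omega_inl_inr]
  · simp [h, hX.omega_inl_inl]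
  · simp [hX.cplx_inl, hX.omega_inr_inr]
  · rw [h, map_neg, ← D.omega_skew, hX.omega_inl_inr]
    simp [eq_comm]

variable [FiniteDimensional ℝ E] [LieGroup 𝓘(ℝ, E) ∞ G] [LieGroup 𝓘(ℝ, F) ∞ H]

/-- A lift of the isotropy representation takes values in `Û(n)`. -/
theorem HermitianSymmetricData.IsLift.mem_UHat (hHconn : IsConnected (H : Set G))
    (hH : MDifferentiableAt 𝓘(ℝ, F) 𝓘(ℝ, E) (Subtype.val : H → G) 1)
    (hX : D.IsUnitaryBasis X) {kap : H →* Mp n} (hkap : D.IsLift X kap) (h : H) :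
    kap h ∈ UHat n := by
  have hconn : PreconnectedSpace H := isPreconnected_iff_preconnectedSpace.1 hHconn.isPreconnected
  -- The functional `Y ↦ ω₀(Y, J₀ Xᵢ)` on `𝔪`, extended to all of `𝔤`. By orthonormality it reads
  -- off the `i`-th coordinate, so the matrix entries of `Ad(h)` become differentiable functions of
  -- `h`.
  have hc (i : Fin n ⊕ Fin n) : ∃ c : E →L[ℝ] ℝ, ∀ Y : D.m,
      c (Y : GroupLieAlgebra 𝓘(ℝ, E) G) = D.omega Y (D.cplx (X i)) := by
    obtain ⟨c, hc⟩ := LinearMap.exists_extend (D.omega.flip (D.cplx (X i)))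
    exact ⟨LinearMap.toContinuousLinearMap (E := E) c, fun Y => LinearMap.congr_fun hc Y⟩
  choose c hc using hc
  choose L hL hLZ using fun j =>
    exists_hasMFDerivAt_Ad (E := E) (G := G) (X j : GroupLieAlgebra 𝓘(ℝ, E) G)
  let A : H →* Matrix (Fin n ⊕ Fin n) (Fin n ⊕ Fin n) ℝ :=
    (symplecticGroup (Fin n) ℝ).subtype.comp (Mp.rho.comp kap)
  have hA (h : H) (i j) : A h i j = c i (Ad (h : G) (X j : GroupLieAlgebra 𝓘(ℝ, E) G)) := by
    have h1 := congrArg (c i) (hkap.rho_eq h j)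
    refine Eq.trans ?_ h1.symm
    have h2 : ∑ i, ((Mp.rho (kap h) : symplecticGroup (Fin n) ℝ) :
        Matrix (Fin n ⊕ Fin n) (Fin n ⊕ Fin n) ℝ) i j • (X i : GroupLieAlgebra 𝓘(ℝ, E) G) =
        ((∑ i, A h i j • X i : D.m) : GroupLieAlgebra 𝓘(ℝ, E) G) := by
      simp [A]
    rw [h2]
    refine Eq.trans ?_ (hc i _).symm
    simp [hX.omega_cplx, -Fintype.sum_sum_type]
  set T : F →L[ℝ] E := mfderiv 𝓘(ℝ, F) 𝓘(ℝ, E) (Subtype.val : H → G) 1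
  have hTm (ξ : F) : (T ξ : GroupLieAlgebra 𝓘(ℝ, E) G) ∈ lieSubalg E F H := ⟨ξ, rfl⟩
  -- `c i (L j Z)` is the metric pairing of `[Z, Xⱼ]`, which lies in `𝔪`, with `Xᵢ`; invariance of
  -- `ω₀` and `J₀` makes `ad Z` skew for the metric.
  have hskew (i j) (Z : GroupLieAlgebra 𝓘(ℝ, E) G) (hZ : Z ∈ lieSubalg E F H) :
      c i (L j Z) + c j (L i Z) = 0 := by
    have h1 (i j) : c i (L j Z) = D.omega ⟨⁅Z, (X j : GroupLieAlgebra 𝓘(ℝ, E) G)⁆,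
        D.bracket_h_m Z hZ _ (X j).2⟩ (D.cplx (X i)) :=
      (congrArg (c i) (hLZ j Z)).trans (hc i ⟨_, D.bracket_h_m Z hZ _ (X j).2⟩)
    rw [h1, h1, D.metric_symm _ (X j), D.cplx_invariant Z hZ]
    exact D.omega_invariant Z hZ _ _
  have horth := mul_transpose_eq_one_of_skew A (b := fun i j => (c i).comp ((L j).comp T))
    (fun i j => by
      have h1 : HasMFDerivAt (M' := E) 𝓘(ℝ, F) 𝓘(ℝ, E)
          (fun h : H => Ad (h : G) (X j : GroupLieAlgebra 𝓘(ℝ, E) G)) 1 ((L j).comp T) :=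
        HasMFDerivAt.comp (M'' := E) (I'' := 𝓘(ℝ, E)) (1 : H)
          (g := fun g : G => Ad g (X j : GroupLieAlgebra 𝓘(ℝ, E) G))
          (hL j) hH.hasMFDerivAt
      have h2 := HasMFDerivAt.comp (1 : H) (c i).hasMFDerivAt h1
      have h3 : (fun h => A h i j) = c i ∘ (fun h : H => Ad (h : G) (X j)) :=
        funext fun h => hA h i j
      rw [h3]
      exact h2)
    (fun i j => by
      ext ξ
      exact hskew i j _ (hTm ξ)) h
  -- Multiplying the symplectic relation on the right by `A` and using `Aᵀ A = 1` gives `A J = J A`.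
  have h1 : A h * J (Fin n) ℝ * (A h)ᵀ = J (Fin n) ℝ :=
    SymplecticGroup.mem_iff.1 (Mp.rho (kap h)).2
  have h2 := congrArg (· * A h) h1
  simp only [Matrix.mul_assoc, mul_eq_one_comm.1 horth, Matrix.mul_one] at h2
  exact h2

end Isotropy

end SymplecticSpinor

end

open SymplecticSpinor in
theorem mainTheorem12
    {E : Type*} [NormedAddCommGroup E] [NormedSpace ℝ E] [FiniteDimensional ℝ E]
    {G : Type*} [TopologicalSpace G] [T2Space G] [ChartedSpace E G] [Group G]
    [LieGroup 𝓘(ℝ, E) ∞ G] [SimplyConnectedSpace G]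
    {F : Type*} [NormedAddCommGroup F] [NormedSpace ℝ F] [FiniteDimensional ℝ F]
    (H : Subgroup G) [ChartedSpace F H] [LieGroup 𝓘(ℝ, F) ∞ H]
    (hHclosed : IsClosed (H : Set G)) (hHconn : IsConnected (H : Set G))
    (hHemb : IsSmoothEmbedding 𝓘(ℝ, F) 𝓘(ℝ, E) ∞ (Subtype.val : H → G))
    (D : HermitianSymmetricData E F H)
    (n : ℕ) (hn : 1 ≤ n)
    (X : Module.Basis (Fin n ⊕ Fin n) ℝ D.m) (hX : D.IsUnitaryBasis X)
    (kap : H →* Mp n) (hkap : D.IsLift X kap) :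
    ∃ (hU : ∀ h, kap h ∈ UHat n)
      (hW : ∀ l (q : UHat n), ∀ w ∈ W n l, unitaryRep n q w ∈ W n l),
      (∀ (l : ℕ) (x : G ⧸ H), FiniteDimensional ℂ (Assoc.Fibre (spinorRepW kap hU hW l) x)) ∧
      (∀ x : G ⧸ H, IsHilbertSum ℂ (fun l : ℕ => Assoc.Fibre (spinorRepW kap hU hW l) x)
        (fun l => inclQFibre kap hU hW x l)) ∧
      (∀ l : ℕ, IsClosedEmbedding (inclQ kap hU hW l)) ∧
      (∀ x₀ : G ⧸ H, ∃ (t : Bundle.Trivialization (L2 n) (Assoc.proj (spinorRep kap)))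
        (s : ∀ l : ℕ, Bundle.Trivialization (W n l) (Assoc.proj (spinorRepW kap hU hW l))),
        x₀ ∈ t.baseSet ∧ Assoc.IsUnitaryTrivialization t ∧
        ∀ l : ℕ, (s l).baseSet = t.baseSet ∧ Assoc.IsUnitaryTrivialization (s l) ∧
          ∀ q : Assoc (spinorRepW kap hU hW l),
            Assoc.proj (spinorRepW kap hU hW l) q ∈ t.baseSet →
              t (inclQ kap hU hW l q) =
                (Assoc.proj (spinorRepW kap hU hW l) q, ((s l q).2 : L2 n))) := by
  have htop : IsTopologicalGroup G := topologicalGroup_of_lieGroup 𝓘(ℝ, E) ∞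
  have hU : ∀ h, kap h ∈ UHat n :=
    hkap.mem_UHat hHconn (hHemb.contMDiff.mdifferentiableAt (by simp)) hX
  refine ⟨hU, unitaryRep_mem_W, finiteDimensional_fibre hU, isHilbertSum_fibre hU,
    isClosedEmbedding_inclQ hU, fun x₀ => ?_⟩
  obtain ⟨U, s, hUo, hx₀, hs, hsU⟩ := exists_section (hHemb.isImmersion.isImmersionAt 1) x₀
  exact exists_trivializations hU hkap.continuous hUo hs hsU hx₀
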